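/- **Conventions.** For a tuple $\mathbf B=(B_1,\dots,B_p)$ of endomorphisms of a complex vector space $V$, write $\mathbf B\sim\mathbf B'$ for simultaneous conjugacy, and call $\mathbf B$ irreducible if $0$ and $V$ are its only common invariant subspaces. Put $M_a(\mathbf B)=(B_1+a_1,\dots,B_p+a_p)$ for $a\in\mathbb C^p$, and let $T_{(j,\infty)}(\mathbf B)$ be $\mathbf B$ with $B_j$ replaced by $-(B_1+\cdots+B_p)$. The middle convolution $mc_\lambda(\mathbf B)$ is the tuple induced on $V^p/(\mathcal K+\mathcal L_\lambda)$ by $G_1,\dots,G_p$, where $G_j$ maps $(u_1,\dots,u_p)$ to the vector with $j$-th component $\sum_\nu B_\nu u_\nu+\lambda u_j$ and all other components $0$, $\mathcal K=\{(u_1,\dots,u_p) : B_ju_j=0\ \forall j\}$ and $\mathcal L_\lambda=\ker(G_1+\cdots+G_p)$. A $p$-tuple is identified with the $(p+1)$-tuple obtained by appending $0$. For $m_1\ge\cdots\ge m_N\ge 0$ and $\lambda_i\in\mathbb C$, $L(m;\lambda)$ is the block matrix with $(i,i)$ block $\lambda_iI_{m_i}$, $(i,i+1)$ block the $m_i\times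 m_{i+1}$ matrix $(\delta_{ab})$, and all other blocks $0$; for unordered $m$ one first arranges the pairs $(\lambda_i,m_i)$ so that the $m_i$ decrease. A tuple $(B_1,\dots,B_p)$ has a Riemann scheme with columns $[\lambda_{j,1}]_{(m_{j,1})},[\lambda_{j,2}]_{(m_{j,2})},\dots$ at $x=t_j$ ($j=1,\dots,p$) and at $x=\infty$ ($j=0$) if $B_j\sim L(m_j;\lambda_j)$ for $j=0,\dots,p$, where $B_0=-(B_1+\cdots+B_p)$. Multiplicities $0$ are allowed. A system of Okubo normal form (ONF) with $p$ finite singular points is $(x-T)\frac{du}{dx}=Au$ with $T=\mathrm{diag}(t_1I_{n_1},\dots,t_pI_{n_p})$, $t_i$ distinct, $n_j\ge1$, and $A=(A_{ij})\in M(n,\mathbb C)$, $n=n_1+\cdots+n_p$, partitioned accordingly. It is identified with the tuple $(A_1,\dots,A_p)$, where $A_j$ has the same $j$-th block row as $A$ and zeros elsewhere. It is linearly irreducible if this tuple is irreducible. **Theorem (Restricting operation).** Let $p\ge2$ and let $(x-T)\frac{du}{dx}=Au$ be a linearly irreducible system of ONF as above, with Riemann scheme $$\begin{Bmatrix} x=\infty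 & x=t_j\ (1\le j\le p)\\ [-\mu_1]_{(m_1)} & [0]_{(n-n_j)}\\ [-\mu_2]_{(m_2)} & [\lambda_{j,1}]_{(\ell_{j,1})}\\ & \vdots\\ & [\lambda_{j,r_j}]_{(\ell_{j,r_j})}\end{Bmatrix}$$ (so there are only two entries at $\infty$; $\mu_1=\mu_2$ is allowed). Assume $\mu_1+\mu_2\ne\lambda_{p,\nu}$ for $\nu=1,\dots,r_p$. Let $\check T=\mathrm{diag}(t_1I_{n_1},\dots,t_{p-1}I_{n_{p-1}})$ and $\check A=(A_{ij})_{1\le i,j\le p-1}$ be the upper left blocks of $T$ and $A$. Then: 1. $mc_{\mu_1}\circ T_{(p,\infty)}\circ M_{(0,\dots,0,\mu_1-\mu_2)}\circ mc_{-\mu_1}(A_1,\dots,A_p)\sim(\check A_1,\dots,\check A_{p-1},0)$, where $(\check A_1,\dots,\check A_{p-1})$ is the tuple of the system $(x-\check T)\frac{du}{dx}=\check Au$ of ONF, whose rank is $\check n=n-n_p$. 2. The system $(x-\check T)\frac{du}{dx}=\check Au$ is linearly irreducible. 3. $m_1\ge n_p$, $m_2\ge n_p$, and the system $(x-\check T)\frac{du}{dx}=\check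 Au$ has the Riemann scheme $$\begin{Bmatrix} x=\infty & x=t_j\ (1\le j\le p-1)\\ [-\mu_1]_{(m_1-n_p)} & [0]_{(\check n-n_j)}\\ [-\mu_2]_{(m_2-n_p)} & [\lambda_{j,1}]_{(\ell_{j,1})}\\ [\lambda_{p,1}-\mu_1-\mu_2]_{(\ell_{p,1})} & \vdots\\ \vdots & [\lambda_{j,r_j}]_{(\ell_{j,r_j})}\\ [\lambda_{p,r_p}-\mu_1-\mu_2]_{(\ell_{p,r_p})} & \end{Bmatrix}.$$ 4. The operation is inverse to the extending operation $E=mc_{\mu_1}\circ M_{(0,\dots,0,\mu_2-\mu_1)}\circ T_{(p,\infty)}\circ mc_{-\mu_1}$ on $(p-1)$-tuples (identified with $p$-tuples with last entry $0$ before $T_{(p,\infty)}$ is applied): $E(\check A_1,\dots,\check A_{p-1})\sim(A_1,\dots,A_p)$, and if $\mathbf A^0$ is the tuple of any linearly irreducible system of ONF with $p-1$ finite singular points such that $E(\mathbf A^0)\sim(A_1,\dots,A_p)$, then $\mathbf A^0\sim(\check A_1,\dots,\check A_{p-1})$. -/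

import Mathlib

noncomputable section

/-! ### Tuples of residue matrices

A Fuchsian system `du/dx = ∑ j, A j / (x - t j) u` in Schlesinger canonical form is given by its
tuple of residues `A : Fin p → Module.End ℂ V`. -/

/-- `A ∼ B`: simultaneous conjugacy of two tuples of endomorphisms. -/
def TupleEquiv {p : ℕ} {V W : Type*} [AddCommGroup V] [Module ℂ V] [AddCommGroup W] [Module ℂ W]
    (A : Fin p → Module.End ℂ V) (B : Fin p → Module.End ℂ W) : Prop :=
  ∃ e : V ≃ₗ[ℂ] W, ∀ j v, e (A j v) = B j (e v)

/-- Irreducibility of a tuple: the only common invariant subspaces are `0` and the whole space.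
The corresponding system is then called linearly irreducible. -/
def TupleIrreducible {p : ℕ} {V : Type*} [AddCommGroup V] [Module ℂ V]
    (A : Fin p → Module.End ℂ V) : Prop :=
  ∀ W : Submodule ℂ V, (∀ j, ∀ v ∈ W, A j v ∈ W) → W = ⊥ ∨ W = ⊤

/-- The addition `M_a (A₁, …, A_p) = (A₁ + a₁, …, A_p + a_p)`. -/
def addition {p : ℕ} {V : Type*} [AddCommGroup V] [Module ℂ V]
    (a : Fin p → ℂ) (A : Fin p → Module.End ℂ V) : Fin p → Module.End ℂ V :=
  fun j => A j + a j • LinearMap.id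

/-- `T_{(j,∞)}`: the `j`-th entry is replaced by the residue `-(A₁ + ⋯ + A_p)` at infinity. -/
def swapInfinity {p : ℕ} {V : Type*} [AddCommGroup V] [Module ℂ V]
    (j : Fin p) (A : Fin p → Module.End ℂ V) : Fin p → Module.End ℂ V :=
  Function.update A j (-∑ i, A i)

/-- The identification of `p`-tuples with the `(p+1)`-tuples whose last entry is `0`. -/
def appendZero {p : ℕ} {V : Type*} [AddCommGroup V] [Module ℂ V]
    (A : Fin p → Module.End ℂ V) : Fin (p + 1) → Module.End ℂ V :=
  Fin.snoc (α := fun _ => Module.End ℂ V) A 0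

/-! ### Middle convolution -/

/-- The convolution matrix `G_j`, acting on `V^p`: its `j`-th block row is
`(A₁, …, A_j + c, …, A_p)`, and its other block rows are zero. -/
def convMap {p : ℕ} {V : Type*} [AddCommGroup V] [Module ℂ V]
    (c : ℂ) (A : Fin p → Module.End ℂ V) (j : Fin p) : Module.End ℂ (Fin p → V) :=
  LinearMap.single ℂ (fun _ : Fin p => V) j ∘ₗ
    ((∑ i, A i ∘ₗ LinearMap.proj i) + c • LinearMap.proj j)

/-- `𝒦 = {(u₁, …, u_p) ; A_j u_j = 0 for all j}`. -/
def convK {p : ℕ} {V : Type*} [AddCommGroup V] [Module ℂ V]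
    (A : Fin p → Module.End ℂ V) : Submodule ℂ (Fin p → V) :=
  Submodule.pi Set.univ fun j => LinearMap.ker (A j)

/-- `ℒ_c = ker (G₁ + ⋯ + G_p)`. -/
def convL {p : ℕ} {V : Type*} [AddCommGroup V] [Module ℂ V]
    (c : ℂ) (A : Fin p → Module.End ℂ V) : Submodule ℂ (Fin p → V) :=
  LinearMap.ker (∑ j, convMap c A j)

theorem convMap_apply {p : ℕ} {V : Type*} [AddCommGroup V] [Module ℂ V]
    (c : ℂ) (A : Fin p → Module.End ℂ V) (j : Fin p) (u : Fin p → V) :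
    convMap c A j u = Pi.single j ((∑ i, A i (u i)) + c • u j) := by
  simp [convMap]

theorem convMap_invariant {p : ℕ} {V : Type*} [AddCommGroup V] [Module ℂ V]
    (c : ℂ) (A : Fin p → Module.End ℂ V) (j : Fin p) :
    convK A ⊔ convL c A ≤ (convK A ⊔ convL c A).comap (convMap c A j) := by
  refine sup_le (fun u hu => ?_) (fun u hu => ?_)
  · have hu' : ∀ i, A i (u i) = 0 := by simpa [convK, Submodule.mem_pi] using hu
    refine Submodule.mem_sup_left ?_
    rw [convMap_apply]
    simp only [convK, Submodule.mem_pi, Set.mem_univ, forall_const, LinearMap.mem_ker]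
    intro i
    by_cases h : i = j
    · subst h
      simp [hu']
    · simp [Pi.single_eq_of_ne h]
  · have hu' : (∑ i, convMap c A i) u = 0 := hu
    have h0 : convMap c A j u = 0 := by
      have h1 := congrFun hu' j
      simp only [LinearMap.sum_apply, Finset.sum_apply, convMap_apply, Pi.zero_apply] at h1
      rw [Finset.sum_eq_single j (fun i _ hij => by simp [Pi.single_eq_of_ne hij.symm])
        (by simp)] at h1
      rw [convMap_apply]
      simpa using h1
    simp [h0]

/-- The space `V^p / (𝒦 + ℒ_c)` on which the middle convolution acts. -/
abbrev MCSpace {p : ℕ} {V : Type*} [AddCommGroup V] [Module ℂ V]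
    (c : ℂ) (A : Fin p → Module.End ℂ V) : Type _ :=
  (Fin p → V) ⧸ (convK A ⊔ convL c A)

/-- The middle convolution `mc_c (A₁, …, A_p)`: the maps induced by the `G_j` on
`V^p / (𝒦 + ℒ_c)`. -/
def mc {p : ℕ} {V : Type*} [AddCommGroup V] [Module ℂ V]
    (c : ℂ) (A : Fin p → Module.End ℂ V) : Fin p → Module.End ℂ (MCSpace c A) :=
  fun j => Submodule.mapQ _ _ (convMap c A j) (convMap_invariant c A j)

/-- The restricting operation on tuples,
`mc_{μ₁} ∘ T_{(p,∞)} ∘ M_{(0,…,0,μ₁-μ₂)} ∘ mc_{-μ₁}`. The number of entries is `p + 1` here, so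
that the last one has index `Fin.last p`. -/
def restrictingOp {p : ℕ} {V : Type*} [AddCommGroup V] [Module ℂ V]
    (μ₁ μ₂ : ℂ) (A : Fin (p + 1) → Module.End ℂ V) :=
  mc μ₁ (swapInfinity (Fin.last p)
    (addition (Pi.single (Fin.last p) (μ₁ - μ₂)) (mc (-μ₁) A)))

/-- The extending operation on tuples,
`mc_{ρ₁} ∘ M_{(0,…,0,ρ₂-ρ₁)} ∘ T_{(p+1,∞)} ∘ mc_{-ρ₁}`. -/
def extendingOp {p : ℕ} {V : Type*} [AddCommGroup V] [Module ℂ V]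
    (ρ₁ ρ₂ : ℂ) (A : Fin p → Module.End ℂ V) :=
  mc ρ₁ (addition (Pi.single (Fin.last p) (ρ₂ - ρ₁))
    (swapInfinity (Fin.last p) (appendZero (mc (-ρ₁) A))))

/-! ### Riemann schemes -/

/-- The matrix `L(m₁, …, m_N; l₁, …, l_N)` attached to a list of pairs `(l_i, m_i)` with
`m₁ ≥ ⋯ ≥ m_N`: its `(i,i)` block is `l_i I`, its `(i,i+1)` block is the `m_i × m_{i+1}` matrix
`(δ_{ab})`, and its other blocks are zero. -/
def blockNormalForm (l : List (ℂ × ℕ)) :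
    Matrix (Σ i : Fin l.length, Fin (l.get i).2) (Σ i : Fin l.length, Fin (l.get i).2) ℂ :=
  Matrix.of fun x y =>
    if x = y then (l.get x.1).1
    else if (y.1 : ℕ) = (x.1 : ℕ) + 1 ∧ (x.2 : ℕ) = (y.2 : ℕ) then 1
    else 0

/-- `f ∼ L(m; l)` for a list of pairs `(l_i, m_i)` in any order: after the list has been arranged
so that the multiplicities decrease, `f` has the matrix `L(m; l)` in a suitable basis.
Some of the multiplicities may be `0`. -/
def HasSpectralData {V : Type*} [AddCommGroup V] [Module ℂ V]
    (f : Module.End ℂ V) (l : List (ℂ × ℕ)) : Prop :=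
  ∃ l' : List (ℂ × ℕ), l'.Perm l ∧ l'.Pairwise (fun a b => b.2 ≤ a.2) ∧
    ∃ b : Module.Basis (Σ i : Fin l'.length, Fin (l'.get i).2) ℂ V,
      LinearMap.toMatrix b b f = blockNormalForm l'

/-- The tuple `A` has the Riemann scheme with column `colInf` at `x = ∞`, where the residue is
`-(A₁ + ⋯ + A_p)`, and with column `col j` at `x = t_j`. An entry `[l]_{(m)}` of a column is the
pair `(l, m)`. -/
def HasRiemannScheme {p : ℕ} {V : Type*} [AddCommGroup V] [Module ℂ V]
    (A : Fin p → Module.End ℂ V) (colInf : List (ℂ × ℕ)) (col : Fin p → List (ℂ × ℕ)) : Prop :=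
  HasSpectralData (-∑ j, A j) colInf ∧ ∀ j, HasSpectralData (A j) (col j)

/-! ### Okubo normal form -/

/-- A system `(x - T) du/dx = A u` of Okubo normal form with
`T = diag(t₁ I_{n₁}, …, t_p I_{n_p})`; the matrix `A` is indexed by pairs
(block `j`, position inside the block). -/
structure OkuboSystem (p : ℕ) where
  /-- the sizes `n_j` of the blocks -/
  size : Fin p → ℕ
  size_pos : ∀ j, 0 < size j
  /-- the finite singular points `t_j` -/
  t : Fin p → ℂ
  t_injective : Function.Injective t
  /-- the matrix `A = (A_{ij})` -/
  A : Matrix (Σ j, Fin (size j)) (Σ j, Fin (size j)) ℂ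

namespace OkuboSystem

/-- The matrix `T = diag(t₁ I_{n₁}, …, t_p I_{n_p})`. -/
def T {p : ℕ} (S : OkuboSystem p) : Matrix (Σ j, Fin (S.size j)) (Σ j, Fin (S.size j)) ℂ :=
  Matrix.diagonal fun i => S.t i.1

/-- The rank `n = n₁ + ⋯ + n_p` of the system. -/
def rank {p : ℕ} (S : OkuboSystem p) : ℕ := ∑ j, S.size j

/-- The residue `A_j` of `(x - T)⁻¹ A` at `x = t_j`: the `j`-th block row of `A_j` is that of `A`,
and its other block rows are zero. -/
def residue {p : ℕ} (S : OkuboSystem p) :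
    Fin p → Module.End ℂ ((Σ j, Fin (S.size j)) → ℂ) :=
  fun j => Matrix.toLin' (Matrix.of fun i k => if i.1 = j then S.A i k else 0)

/-- The position of the first `p` blocks among all `p + 1` blocks. -/
def firstBlocks {p : ℕ} (n : Fin (p + 1) → ℕ) :
    (Σ j : Fin p, Fin (n j.castSucc)) → (Σ j : Fin (p + 1), Fin (n j)) :=
  fun i => ⟨i.1.castSucc, i.2⟩

/-- The system given by the upper left blocks of `T` and `A`: the last block row and the last
block column are deleted. -/
def restrict {p : ℕ} (S : OkuboSystem (p + 1)) : OkuboSystem p where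
  size := fun j => S.size j.castSucc
  size_pos := fun j => S.size_pos j.castSucc
  t := fun j => S.t j.castSucc
  t_injective := S.t_injective.comp (Fin.castSucc_injective p)
  A := S.A.submatrix (firstBlocks S.size) (firstBlocks S.size)

end OkuboSystem

end

/-! Let `V` be the sum of all blocks but the last, `U` the last block, and `F = (A, X; Y, D)` the
Okubo matrix. Having only two entries at infinity means (F - μ₁)(F - μ₂) = 0, that is, XY = -(A -
μ₁)(A - μ₂), XD = (μ₁ + μ₂ - A)X, DY = Y(μ₁ + μ₂ - A), and a fourth relation that is not needed.
Tested on suitable subspaces, irreducibility makes `X` injective, `Y` surjective and, as μ₁ + μ₂ is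
not an eigenvalue of `D`, `A` injective; it then descends to `A` (`block_restrict_irreducible`).

By `mc_okubo`, mc_{-μ₁} of the tuple P_j F is R P_j on the range of R = F - μ₁. These maps add up to
`R`, which is the scalar μ₂ - μ₁ on its own range. The addition therefore makes the residue at
infinity vanish, the swap puts 0 in the last place, and mc_{μ₁} rebuilds `V` and `A` alone
(`restrictingOp_okubo`). Starting from `A` instead, the last entry becomes μ₂ - A on the range of A
- μ₁; its image is the range of XY, a copy of `U`, and mc_{μ₁} rebuilds `F` (`extendingOp_okubo`).
For uniqueness, the extension of any irreducible Okubo tuple is conjugate to a block system with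
that tuple in the corner, and conjugacies of such systems respect the blocks
(`tupleEquiv_of_blockMap`).

For the Riemann schemes, conjugacy to L(m; λ) is expressed by the dimensions of ker (f - b)^k.
Restricting f to the image of f - a removes exactly one entry (a, m) (`IsReduction`). A residue
reduces at 0 to its diagonal block, which the restriction does not touch. At infinity, -A reduces at
-μ₁ and then at -μ₂ (or in the other order) to D - μ₁ - μ₂ on `U`, which explains the new column. -/

noncomputable section

/-! ### Ranks attached to a normal form -/

/-- The multiplicities of the eigenvalue `b` in a list of pairs, in the order of the list. -/
def multiplicities (l : List (ℂ × ℕ)) (b : ℂ) : List ℕ :=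
  (l.filter fun x => x.1 = b).map Prod.snd

theorem multiplicities_nil (b : ℂ) : multiplicities [] b = [] := rfl

theorem multiplicities_cons (a b : ℂ) (m : ℕ) (l : List (ℂ × ℕ)) :
    multiplicities ((a, m) :: l) b =
      if a = b then m :: multiplicities l b else multiplicities l b := by
  by_cases h : a = b <;> simp [multiplicities, h]

theorem List.Perm.multiplicities {l l' : List (ℂ × ℕ)} (h : l.Perm l') (b : ℂ) :
    (multiplicities l b).Perm (multiplicities l' b) :=
  (h.filter _).map _

theorem List.Pairwise.multiplicities {l : List (ℂ × ℕ)}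
    (h : l.Pairwise fun a b => b.2 ≤ a.2) (b : ℂ) : (multiplicities l b).Pairwise (· ≥ ·) :=
  List.pairwise_map.2 (h.filter _)

theorem multiplicities_map_add (l : List (ℂ × ℕ)) (b c : ℂ) :
    multiplicities (l.map fun x => (x.1 + c, x.2)) b = multiplicities l (b - c) := by
  induction l with
  | nil => rfl
  | cons x l ih =>
    obtain ⟨a, m⟩ := x
    rw [List.map_cons, multiplicities_cons, multiplicities_cons, ih]
    simp only [eq_sub_iff_add_eq]

theorem le_sum_take_one {l : List ℕ} (h : l.Pairwise (· ≥ ·)) {x : ℕ} (hx : x ∈ l) :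
    x ≤ (l.take 1).sum := by
  cases l with
  | nil => simp at hx
  | cons y l =>
    rcases List.mem_cons.1 hx with rfl | hx
    · simp
    · simpa using (List.pairwise_cons.1 h).1 x hx

/-- The dimensions of the kernels of the powers of `f - b` are those of `L(m; l)`. -/
def HasKernelDims {V : Type*} [AddCommGroup V] [Module ℂ V]
    (f : Module.End ℂ V) (l : List (ℂ × ℕ)) : Prop :=
  Module.finrank ℂ V = (l.map Prod.snd).sum ∧
    ∀ b k, Module.finrank ℂ (LinearMap.ker ((f - b • 1) ^ k)) =
      ((multiplicities l b).take k).sum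

/-! ### Passing to the image of `f - a`. -/

/-- `f` and `h` are obtained from each other by passing to the image of `f - a`: there is a
factorization `f - a = i ∘ s` with `i` injective and `s` surjective, and `h - a = s ∘ i`. -/
structure IsReduction {V U : Type*} [AddCommGroup V] [Module ℂ V] [AddCommGroup U] [Module ℂ U]
    (a : ℂ) (f : Module.End ℂ V) (h : Module.End ℂ U) (i : U →ₗ[ℂ] V) (s : V →ₗ[ℂ] U) :
    Prop where
  inj : Function.Injective i
  surj : Function.Surjective s
  eq_left : ∀ v, f v = a • v + i (s v)
  eq_right : ∀ u, h u = a • u + s (i u)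

namespace IsReduction

variable {V U : Type*} [AddCommGroup V] [Module ℂ V] [AddCommGroup U] [Module ℂ U]
  {a : ℂ} {f : Module.End ℂ V} {h : Module.End ℂ U} {i : U →ₗ[ℂ] V} {s : V →ₗ[ℂ] U}

/-- Both s f and h s equal a s + s i s; symmetrically i h = f i, used in `pow_comp_i`. -/
theorem pow_comp_s (H : IsReduction a f h i s) (b : ℂ) (k : ℕ) (v : V) :
    s (((f - b • 1) ^ k) v) = ((h - b • 1) ^ k) (s v) := by
  induction k generalizing v with
  | zero => simp
  | succ k ih =>
    rw [pow_succ, pow_succ, Module.End.mul_apply, Module.End.mul_apply, ih]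
    congr 1
    simp [H.eq_left, H.eq_right]

theorem pow_comp_i (H : IsReduction a f h i s) (b : ℂ) (k : ℕ) (u : U) :
    i (((h - b • 1) ^ k) u) = ((f - b • 1) ^ k) (i u) := by
  induction k generalizing u with
  | zero => simp
  | succ k ih =>
    rw [pow_succ, pow_succ, Module.End.mul_apply, Module.End.mul_apply, ih]
    congr 1
    simp [H.eq_left, H.eq_right]

theorem pow_succ_apply (H : IsReduction a f h i s) (k : ℕ) (v : V) :
    ((f - a • 1) ^ (k + 1)) v = i (((h - a • 1) ^ k) (s v)) := by
  rw [pow_succ, Module.End.mul_apply, H.pow_comp_i]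
  congr 1
  simp [H.eq_left]

/-- The kernels embed into each other by `s` and `i`: on ker s the map f is the scalar a ≠ b, so `s`
loses nothing of ker (f - b)^k. -/
theorem finrank_ker_of_ne [FiniteDimensional ℂ V] [FiniteDimensional ℂ U]
    (H : IsReduction a f h i s) {b : ℂ} (hb : a ≠ b) (k : ℕ) :
    Module.finrank ℂ (LinearMap.ker ((f - b • 1) ^ k)) =
      Module.finrank ℂ (LinearMap.ker ((h - b • 1) ^ k)) := by
  apply le_antisymm
  · refine LinearMap.finrank_le_finrank_of_injective
      (f := s.restrict (p := LinearMap.ker ((f - b • 1) ^ k))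
        (q := LinearMap.ker ((h - b • 1) ^ k)) fun v hv => ?_) ?_
    · rw [LinearMap.mem_ker] at hv ⊢
      rw [← H.pow_comp_s, hv, map_zero]
    · rw [injective_iff_map_eq_zero]
      rintro ⟨v, hv⟩ h0
      have hs : s v = 0 := congrArg Subtype.val h0
      have hf : (f - b • 1) v = (a - b) • v := by simp [H.eq_left, hs, sub_smul]
      have hk : ∀ k : ℕ, ((f - b • 1) ^ k) v = (a - b) ^ k • v := by
        intro k
        induction k with
        | zero => simp
        | succ k ih => rw [pow_succ, Module.End.mul_apply, hf, map_smul, ih, smul_smul, pow_succ,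
            mul_comm]
      rw [LinearMap.mem_ker, hk] at hv
      have := (smul_eq_zero.1 hv).resolve_left (pow_ne_zero _ (sub_ne_zero.2 hb))
      exact Subtype.ext this
  · refine LinearMap.finrank_le_finrank_of_injective
      (f := i.restrict (p := LinearMap.ker ((h - b • 1) ^ k))
        (q := LinearMap.ker ((f - b • 1) ^ k)) fun v hv => ?_) ?_
    · rw [LinearMap.mem_ker] at hv ⊢
      rw [← H.pow_comp_i, hv, map_zero]
    · rintro ⟨v, hv⟩ ⟨w, hw⟩ h0
      exact Subtype.ext (H.inj (congrArg Subtype.val h0))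

/-- Since (f - a)^(k+1) = i (h - a)^k s, its range is a copy of the range of (h - a)^k; the rest is
rank-nullity. -/
theorem finrank_ker_succ [FiniteDimensional ℂ V] [FiniteDimensional ℂ U]
    (H : IsReduction a f h i s) (k : ℕ) :
    Module.finrank ℂ (LinearMap.ker ((f - a • 1) ^ (k + 1))) + Module.finrank ℂ U =
      Module.finrank ℂ V + Module.finrank ℂ (LinearMap.ker ((h - a • 1) ^ k)) := by
  have hr : LinearMap.range ((f - a • 1) ^ (k + 1)) =
      (LinearMap.range ((h - a • 1) ^ k)).map i := by
    ext v
    constructor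
    · rintro ⟨w, rfl⟩
      exact ⟨_, ⟨s w, rfl⟩, (H.pow_succ_apply k w).symm⟩
    · rintro ⟨_, ⟨u, rfl⟩, rfl⟩
      obtain ⟨w, rfl⟩ := H.surj u
      exact ⟨w, H.pow_succ_apply k w⟩
  have h1 := LinearMap.finrank_range_add_finrank_ker ((f - a • 1) ^ (k + 1))
  have h2 := LinearMap.finrank_range_add_finrank_ker ((h - a • 1) ^ k)
  rw [hr, ← (Submodule.equivMapOfInjective i H.inj _).finrank_eq] at h1
  omega

theorem finrank_ker [FiniteDimensional ℂ V] [FiniteDimensional ℂ U]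
    (H : IsReduction a f h i s) :
    Module.finrank ℂ (LinearMap.ker (f - a • 1)) + Module.finrank ℂ U = Module.finrank ℂ V := by
  have := H.finrank_ker_succ 0
  have h1 : LinearMap.ker (1 : Module.End ℂ U) = ⊥ := LinearMap.ker_id
  rw [zero_add, pow_one, pow_zero, h1, finrank_bot] at this
  exact this

/-- At `a` the kernel dimensions of `f` are those of `h` with exponent shifted by one and increased
by `m`, which is what prepending `m` does to partial sums. No ordering of the list is needed. -/
theorem hasKernelDims_iff [FiniteDimensional ℂ V] [FiniteDimensional ℂ U]
    (H : IsReduction a f h i s) (m : ℕ) (l : List (ℂ × ℕ)) :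
    HasKernelDims f ((a, m) :: l) ↔
      HasKernelDims h l ∧ Module.finrank ℂ V = m + Module.finrank ℂ U := by
  have h1 := H.finrank_ker
  constructor
  · rintro ⟨hV, hK⟩
    have h2 := hK a 1
    rw [pow_one] at h2
    simp only [multiplicities_cons, if_true, List.take_succ_cons, List.take_zero,
      List.sum_cons, List.sum_nil] at h2
    simp only [List.map_cons, List.sum_cons] at hV
    refine ⟨⟨by omega, fun b k => ?_⟩, by omega⟩
    by_cases hb : a = b
    · subst hb
      have h3 := H.finrank_ker_succ k
      rw [hK] at h3
      simp only [multiplicities_cons, if_true, List.take_succ_cons, List.sum_cons] at h3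
      omega
    · rw [← H.finrank_ker_of_ne hb, hK, multiplicities_cons, if_neg hb]
  · rintro ⟨⟨hU, hK⟩, hV⟩
    refine ⟨by simp only [List.map_cons, List.sum_cons]; omega, fun b k => ?_⟩
    by_cases hb : a = b
    · subst hb
      cases k with
      | zero => simp [Module.End.one_eq_id]
      | succ k =>
        have h3 := H.finrank_ker_succ k
        rw [hK] at h3
        simp only [multiplicities_cons, if_true, List.take_succ_cons, List.sum_cons]
        omega
    · rw [H.finrank_ker_of_ne hb, hK, multiplicities_cons, if_neg hb]

end IsReduction

/-- Every endomorphism is reduced to its restriction to the image of `f - a`. -/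
theorem exists_isReduction_range {V : Type*} [AddCommGroup V] [Module ℂ V]
    (a : ℂ) (f : Module.End ℂ V) :
    IsReduction a f (a • 1 + (f - a • 1).rangeRestrict ∘ₗ (LinearMap.range (f - a • 1)).subtype)
      (LinearMap.range (f - a • 1)).subtype (f - a • 1).rangeRestrict where
  inj := Subtype.val_injective
  surj := LinearMap.surjective_rangeRestrict _
  eq_left v := by simp
  eq_right u := rfl

/-! ### Kernel dimensions determine the conjugacy class. -/

theorem LinearMap.exists_comp_eq_of_ker_le {K V Q W : Type*} [Field K] [AddCommGroup V] [Module K V]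
    [AddCommGroup Q] [Module K Q] [AddCommGroup W] [Module K W] (q : V →ₗ[K] Q) (g : V →ₗ[K] W)
    (h : LinearMap.ker q ≤ LinearMap.ker g) : ∃ γ : Q →ₗ[K] W, ∀ v, γ (q v) = g v := by
  obtain ⟨t, ht⟩ := q.rangeRestrict.exists_rightInverse_of_surjective
    (LinearMap.range_rangeRestrict q)
  obtain ⟨γ, hγ⟩ := LinearMap.exists_extend (g ∘ₗ t)
  refine ⟨γ, fun v => ?_⟩
  have h1 : γ (q v) = g (t (q.rangeRestrict v)) := LinearMap.congr_fun hγ (q.rangeRestrict v)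
  have h2 : q (t (q.rangeRestrict v)) = q v :=
    congrArg Subtype.val (LinearMap.congr_fun ht (q.rangeRestrict v))
  rw [h1, ← sub_eq_zero, ← map_sub]
  exact h (by rw [LinearMap.mem_ker, map_sub, h2, sub_self])

/-- An injective map on a subspace extends to an isomorphism between spaces of the same
dimension. -/
theorem Submodule.exists_linearEquiv_extend {K V W : Type*} [Field K] [AddCommGroup V] [Module K V]
    [AddCommGroup W] [Module K W] [FiniteDimensional K V] [FiniteDimensional K W]
    (hdim : Module.finrank K V = Module.finrank K W) (M : Submodule K V) (g : M →ₗ[K] W)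
    (hg : Function.Injective g) : ∃ e : V ≃ₗ[K] W, ∀ x : M, e x = g x := by
  let e₀ : W ≃ₗ[K] V := LinearEquiv.ofFinrankEq _ _ hdim.symm
  obtain ⟨G, hG⟩ := Submodule.exists_linearEquiv_restrict_eq
    (LinearEquiv.ofInjective (e₀.toLinearMap ∘ₗ g) (e₀.injective.comp hg))
  refine ⟨G ≪≫ₗ e₀.symm, fun x => ?_⟩
  rw [LinearEquiv.trans_apply, ← hG]
  simp

/-- Intertwining isomorphisms extend from the reductions. -/
theorem IsReduction.exists_equiv {V U V' U' : Type*} [AddCommGroup V] [Module ℂ V]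
    [AddCommGroup U] [Module ℂ U] [AddCommGroup V'] [Module ℂ V'] [AddCommGroup U'] [Module ℂ U']
    [FiniteDimensional ℂ V] [FiniteDimensional ℂ V']
    {a : ℂ} {f : Module.End ℂ V} {h : Module.End ℂ U} {i : U →ₗ[ℂ] V} {s : V →ₗ[ℂ] U}
    {f' : Module.End ℂ V'} {h' : Module.End ℂ U'} {i' : U' →ₗ[ℂ] V'} {s' : V' →ₗ[ℂ] U'}
    (H : IsReduction a f h i s) (H' : IsReduction a f' h' i' s')
    (hdim : Module.finrank ℂ V = Module.finrank ℂ V')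
    (e : U ≃ₗ[ℂ] U') (he : ∀ u, e (h u) = h' (e u)) :
    ∃ Φ : V ≃ₗ[ℂ] V', ∀ v, Φ (f v) = f' (Φ v) := by
  have hes : ∀ u, e (s (i u)) = s' (i' (e u)) := by
    intro u
    have := he u
    rw [H.eq_right, H'.eq_right, map_add, map_smul] at this
    exact add_left_cancel this
  obtain ⟨t', ht'⟩ := s'.exists_rightInverse_of_surjective (LinearMap.range_eq_top.2 H'.surj)
  obtain ⟨r, hr⟩ := i.exists_leftInverse_of_injective (LinearMap.ker_eq_bot.2 H.inj)
  have ht : ∀ u, s' (t' u) = u := fun u => LinearMap.congr_fun ht' u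
  have hri : ∀ u, r (i u) = u := fun u => LinearMap.congr_fun hr u
  -- `g₀` satisfies both g₀ i = i' e and s' g₀ = e s, which suffice for intertwining, but it need
  -- not be bijective.
  let g₀ : V →ₗ[ℂ] V' := t' ∘ₗ e.toLinearMap ∘ₗ s +
    (i' ∘ₗ e.toLinearMap - t' ∘ₗ e.toLinearMap ∘ₗ s ∘ₗ i) ∘ₗ r
  have hg₀i : ∀ u, g₀ (i u) = i' (e u) := by
    intro u
    simp [g₀, hri]
  have hg₀s : ∀ v, s' (g₀ v) = e (s v) := by
    intro v
    simp [g₀, ht, hes]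
  let N := LinearMap.ker s
  let N' := LinearMap.ker s'
  have hN : Module.finrank ℂ N = Module.finrank ℂ N' := by
    have h1 := s.finrank_range_add_finrank_ker
    have h2 := s'.finrank_range_add_finrank_ker
    rw [LinearMap.range_eq_top.2 H.surj, finrank_top] at h1
    rw [LinearMap.range_eq_top.2 H'.surj, finrank_top] at h2
    have h3 := e.finrank_eq
    change _ + Module.finrank ℂ N = _ at h1
    change _ + Module.finrank ℂ N' = _ at h2
    omega
  have hg₀N : ∀ v ∈ N, g₀ v ∈ N' := by
    intro v hv
    have hv' : s v = 0 := hv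
    change s' _ = 0
    rw [hg₀s, hv', map_zero]
  -- `g₀` is repaired on N = ker s. It is already injective on the part of `N` inside range i, so it
  -- extends from there to an isomorphism Ψ of `N` onto N'. The difference Ψ - g₀ vanishes on that
  -- part, hence factors through V / range i, and adding it disturbs neither relation.
  let M : Submodule ℂ N := (LinearMap.range i).comap N.subtype
  obtain ⟨Ψ, hΨ⟩ := M.exists_linearEquiv_extend hN (g₀.restrict hg₀N ∘ₗ M.subtype) (by
    rw [injective_iff_map_eq_zero]
    rintro ⟨v, u, hu⟩ h0
    have h1 : g₀ (N.subtype v) = 0 := congrArg Subtype.val h0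
    rw [← hu, hg₀i, map_eq_zero_iff _ H'.inj, e.map_eq_zero_iff] at h1
    rw [h1, map_zero] at hu
    exact Subtype.ext (Subtype.ext hu.symm))
  obtain ⟨δ, hδ⟩ := LinearMap.exists_comp_eq_of_ker_le
    ((LinearMap.range i).mkQ ∘ₗ N.subtype) (Ψ.toLinearMap - g₀.restrict hg₀N) (by
      intro v hv
      have hv' : v ∈ M := by simpa [M] using hv
      have h1 : Ψ v = g₀.restrict hg₀N v := hΨ ⟨v, hv'⟩
      rw [LinearMap.mem_ker, LinearMap.sub_apply, LinearEquiv.coe_coe, h1, sub_self])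
  let Φ : V →ₗ[ℂ] V' := g₀ + N'.subtype ∘ₗ δ ∘ₗ (LinearMap.range i).mkQ
  have hΦi : ∀ u, Φ (i u) = i' (e u) := by
    intro u
    have h1 : (LinearMap.range i).mkQ (i u) = 0 := by simp
    simp only [Φ, LinearMap.add_apply, LinearMap.comp_apply, h1, map_zero, add_zero, hg₀i]
  have hΦs : ∀ v, s' (Φ v) = e (s v) := by
    intro v
    have h1 : s' (N'.subtype (δ ((LinearMap.range i).mkQ v))) = 0 :=
      (δ ((LinearMap.range i).mkQ v)).2
    simp only [Φ, LinearMap.add_apply, LinearMap.comp_apply, map_add, h1, add_zero, hg₀s]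
  have hΦinj : Function.Injective Φ := by
    rw [injective_iff_map_eq_zero]
    intro v hv
    have h1 : s v = 0 := by
      rw [← e.map_eq_zero_iff, ← hΦs, hv, map_zero]
    have h2 : Φ v = Ψ ⟨v, h1⟩ := by
      have h3 := congrArg Subtype.val (hδ ⟨v, h1⟩)
      simp only [LinearMap.comp_apply, Submodule.subtype_apply, LinearMap.sub_apply,
        LinearEquiv.coe_coe, AddSubgroupClass.coe_sub, LinearMap.coe_restrict_apply] at h3
      simp only [Φ, LinearMap.add_apply, LinearMap.comp_apply, Submodule.subtype_apply]
      rw [h3]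
      abel
    rw [hv] at h2
    have h4 : Ψ ⟨v, h1⟩ = 0 := Subtype.ext h2.symm
    exact congrArg Subtype.val (Ψ.map_eq_zero_iff.1 h4)
  refine ⟨LinearEquiv.ofInjectiveOfFinrankEq Φ hΦinj hdim, fun v => ?_⟩
  change Φ (f v) = f' (Φ v)
  rw [H.eq_left, H'.eq_left, hΦs, map_add, map_smul, hΦi]

/-- Two endomorphisms whose kernel dimensions are those of the same normal form are conjugate. -/
theorem HasKernelDims.exists_equiv {V W : Type*} [AddCommGroup V] [Module ℂ V] [AddCommGroup W]
    [Module ℂ W] [FiniteDimensional ℂ V] [FiniteDimensional ℂ W] {f : Module.End ℂ V}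
    {g : Module.End ℂ W} {l : List (ℂ × ℕ)} (hf : HasKernelDims f l) (hg : HasKernelDims g l) :
    ∃ e : V ≃ₗ[ℂ] W, ∀ v, e (f v) = g (e v) := by
  have hdim : Module.finrank ℂ V = Module.finrank ℂ W := hf.1.trans hg.1.symm
  induction l generalizing V W with
  | nil =>
    have hV : Subsingleton V := Module.finrank_zero_iff.1 hf.1
    have hW : Subsingleton W := Module.finrank_zero_iff.1 hg.1
    exact ⟨LinearEquiv.ofFinrankEq _ _ hdim, fun v => Subsingleton.elim _ _⟩
  | cons x l ih =>
    obtain ⟨a, m⟩ := x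
    -- Both maps are reduced along the common head of the list; the conjugacy of the reductions is
    -- then lifted.
    have Hf := exists_isReduction_range a f
    have Hg := exists_isReduction_range a g
    rw [Hf.hasKernelDims_iff] at hf
    rw [Hg.hasKernelDims_iff] at hg
    obtain ⟨e, he⟩ := ih hf.1 hg.1 (hf.1.1.trans hg.1.1.symm)
    exact Hf.exists_equiv Hg hdim e he

/-! ### The normal form has the expected kernel dimensions -/

/-- The positions outside the first block. -/
def tailPos (x : ℂ × ℕ) (l : List (ℂ × ℕ)) (y : Σ i : Fin l.length, Fin (l.get i).2) :
    Σ i : Fin (x :: l).length, Fin ((x :: l).get i).2 :=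
  ⟨y.1.succ, y.2⟩

/-- The positions inside the first block. -/
def headPos (x : ℂ × ℕ) (l : List (ℂ × ℕ)) (b : Fin x.2) :
    Σ i : Fin (x :: l).length, Fin ((x :: l).get i).2 :=
  ⟨(0 : Fin (l.length + 1)), b⟩

theorem eq_headPos_or_eq_tailPos (x : ℂ × ℕ) (l : List (ℂ × ℕ))
    (y : Σ i : Fin (x :: l).length, Fin ((x :: l).get i).2) :
    (∃ b, y = headPos x l b) ∨ ∃ z, y = tailPos x l z := by
  obtain ⟨i, b⟩ := y
  refine Fin.cases (fun b => ?_) (fun j b => ?_) i b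
  · exact Or.inl ⟨b, rfl⟩
  · exact Or.inr ⟨⟨j, b⟩, rfl⟩

theorem headPos_injective (x : ℂ × ℕ) (l : List (ℂ × ℕ)) :
    Function.Injective (headPos x l) := fun _ _ h => eq_of_heq (Sigma.mk.inj h).2

theorem tailPos_ne_headPos (x : ℂ × ℕ) (l : List (ℂ × ℕ)) (y b) :
    tailPos x l y ≠ headPos x l b := fun h => Fin.succ_ne_zero y.1 (congrArg Sigma.fst h)

/-- Extension by zero to the first block. -/
def extendTail (x : ℂ × ℕ) (l : List (ℂ × ℕ)) :
    ((Σ i : Fin l.length, Fin (l.get i).2) → ℂ) →ₗ[ℂ]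
      ((Σ i : Fin (x :: l).length, Fin ((x :: l).get i).2) → ℂ) where
  toFun w := fun y => Fin.cases (motive := fun i => Fin ((x :: l).get i).2 → ℂ)
    (fun _ => 0) (fun j b => w ⟨j, b⟩) y.1 y.2
  map_add' v w := by
    funext y
    obtain ⟨i, b⟩ := y
    refine Fin.cases (fun b => ?_) (fun j b => ?_) i b
    · exact (add_zero _).symm
    · rfl
  map_smul' c w := by
    funext y
    obtain ⟨i, b⟩ := y
    refine Fin.cases (fun b => ?_) (fun j b => ?_) i b
    · exact (mul_zero _).symm
    · rfl

theorem extendTail_zero (x : ℂ × ℕ) (l : List (ℂ × ℕ)) (w) (b) :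
    extendTail x l w (headPos x l b) = 0 := rfl

theorem extendTail_tailPos (x : ℂ × ℕ) (l : List (ℂ × ℕ)) (w) (y) :
    extendTail x l w (tailPos x l y) = w y := rfl

theorem sum_cons_pos (x : ℂ × ℕ) (l : List (ℂ × ℕ))
    (F : (Σ i : Fin (x :: l).length, Fin ((x :: l).get i).2) → ℂ) :
    ∑ y, F y = ∑ b : Fin x.2, F (headPos x l b) + ∑ y, F (tailPos x l y) := by
  rw [Fintype.sum_sigma, Fintype.sum_sigma]
  exact Fin.sum_univ_succ _

theorem blockNormalForm_tailPos (x : ℂ × ℕ) (l : List (ℂ × ℕ)) (y z) :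
    blockNormalForm (x :: l) (tailPos x l y) (tailPos x l z) = blockNormalForm l y z := by
  have h : tailPos x l y = tailPos x l z ↔ y = z := by
    constructor
    · intro h
      obtain ⟨i, b⟩ := y
      obtain ⟨j, c⟩ := z
      simp only [tailPos, Sigma.mk.injEq, Fin.succ_inj] at h
      obtain ⟨rfl, h⟩ := h
      rw [eq_of_heq h]
    · rintro rfl
      rfl
  simp only [blockNormalForm, Matrix.of_apply, h]
  simp [tailPos]

theorem blockNormalForm_zero_col (x : ℂ × ℕ) (l : List (ℂ × ℕ)) (y b) :
    blockNormalForm (x :: l) y (headPos x l b) =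
      if y = (headPos x l b) then x.1 else 0 := by
  have h2 : ¬(((headPos x l b).1 : ℕ) = (y.1 : ℕ) + 1) := by simp [headPos]
  by_cases h : y = (headPos x l b)
  · subst h
    simp [blockNormalForm, headPos]
  · simp only [blockNormalForm, Matrix.of_apply, if_neg h]
    exact if_neg fun h => h2 h.1

theorem block_pos_ext {l : List (ℂ × ℕ)} {y z : Σ i : Fin l.length, Fin (l.get i).2}
    (h1 : (y.1 : ℕ) = z.1) (h2 : (y.2 : ℕ) = z.2) : y = z := by
  obtain ⟨i, b⟩ := y
  obtain ⟨j, c⟩ := z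
  obtain rfl : i = j := Fin.ext h1
  obtain rfl : b = c := Fin.ext h2
  rfl

theorem blockNormalForm_apply_of_succ (l : List (ℂ × ℕ)) (u) {y z}
    (h1 : (z.1 : ℕ) = (y.1 : ℕ) + 1) (h2 : (y.2 : ℕ) = (z.2 : ℕ)) :
    Matrix.toLin' (blockNormalForm l) u y = (l.get y.1).1 * u y + u z := by
  have hne : y ≠ z := by
    rintro rfl
    omega
  rw [Matrix.toLin'_apply, Matrix.mulVec, dotProduct, Fintype.sum_eq_add y z hne]
  · simp [blockNormalForm, hne, h1, h2]
  · rintro w ⟨hw1, hw2⟩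
    have h3 : ¬((w.1 : ℕ) = (y.1 : ℕ) + 1 ∧ (y.2 : ℕ) = (w.2 : ℕ)) := fun h =>
      hw2 (block_pos_ext (h.1.trans h1.symm) (h.2.symm.trans h2))
    simp only [blockNormalForm, Matrix.of_apply, if_neg hw1.symm, if_neg h3, zero_mul]

theorem blockNormalForm_apply_extendTail (x : ℂ × ℕ) (l : List (ℂ × ℕ)) (u) (y) :
    Matrix.toLin' (blockNormalForm (x :: l)) (extendTail x l u) (tailPos x l y) =
      Matrix.toLin' (blockNormalForm l) u y := by
  rw [Matrix.toLin'_apply, Matrix.toLin'_apply, Matrix.mulVec, Matrix.mulVec, dotProduct,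
    dotProduct, sum_cons_pos]
  simp only [blockNormalForm_zero_col, tailPos_ne_headPos, if_false, zero_mul,
    Finset.sum_const_zero, zero_add,
    blockNormalForm_tailPos, extendTail_tailPos]

/-- L - λ₁ kills the coordinates of the first block, so it factors through forgetting them. The
second factor is injective because the sizes decrease: each position in a later block has a position
in the preceding block whose row reads it with coefficient 1. -/
theorem blockNormalForm_isReduction (x : ℂ × ℕ) (l : List (ℂ × ℕ))
    (hl : (x :: l).Pairwise fun a b => b.2 ≤ a.2) :
    IsReduction x.1 (Matrix.toLin' (blockNormalForm (x :: l))) (Matrix.toLin' (blockNormalForm l))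
      ((Matrix.toLin' (blockNormalForm (x :: l)) - x.1 • 1) ∘ₗ extendTail x l)
      (LinearMap.funLeft ℂ ℂ (tailPos x l)) where
  inj := by
    rw [injective_iff_map_eq_zero]
    intro w hw
    -- Block by block: the row one block earlier involves only the preceding coordinate, already
    -- known to vanish, and the wanted one.
    have key : ∀ (n : ℕ) (y : Σ i : Fin l.length, Fin (l.get i).2), (y.1 : ℕ) = n → w y = 0 := by
      intro n
      induction n with
      | zero =>
        rintro ⟨j, b⟩ hj
        have hle : (l.get j).2 ≤ x.2 := (List.pairwise_cons.1 hl).1 _ (List.get_mem l j)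
        have h1 := blockNormalForm_apply_of_succ (x :: l) (extendTail x l w)
          (y := (headPos x l ⟨b, b.2.trans_le hle⟩)) (z := tailPos x l ⟨j, b⟩)
          (by simpa [tailPos, headPos] using hj) rfl
        have h2 := congrFun hw (headPos x l ⟨b, b.2.trans_le hle⟩)
        simp only [LinearMap.comp_apply, LinearMap.sub_apply, Pi.sub_apply, h1,
          LinearMap.smul_apply, Pi.smul_apply, Module.End.one_apply, extendTail_zero,
          extendTail_tailPos] at h2
        simpa using h2
      | succ n ih =>
        rintro ⟨j, b⟩ hj
        have hj' : (j : ℕ) = n + 1 := hj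
        let i : Fin l.length := ⟨n, by omega⟩
        have hle : (l.get j).2 ≤ (l.get i).2 :=
          List.pairwise_iff_get.1 (List.pairwise_cons.1 hl).2 i j (by
            rw [Fin.lt_def]; simp [i, hj'])
        have h1 := blockNormalForm_apply_of_succ (x :: l) (extendTail x l w)
          (y := tailPos x l ⟨i, ⟨b, b.2.trans_le hle⟩⟩) (z := tailPos x l ⟨j, b⟩)
          (by simp [tailPos, hj', i]) rfl
        have h2 := congrFun hw (tailPos x l ⟨i, ⟨b, b.2.trans_le hle⟩⟩)
        simp only [LinearMap.comp_apply, LinearMap.sub_apply, Pi.sub_apply, h1,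
          LinearMap.smul_apply, Pi.smul_apply, Module.End.one_apply,
          extendTail_tailPos] at h2
        simpa [ih ⟨i, ⟨b, b.2.trans_le hle⟩⟩ rfl] using h2
    funext y
    exact key _ y rfl
  surj w := ⟨extendTail x l w, rfl⟩
  eq_left v := by
    have h : (Matrix.toLin' (blockNormalForm (x :: l)) - x.1 • 1)
        (v - extendTail x l (LinearMap.funLeft ℂ ℂ (tailPos x l) v)) = 0 := by
      set u := v - extendTail x l (LinearMap.funLeft ℂ ℂ (tailPos x l) v) with hu
      have hu0 : ∀ y, u (tailPos x l y) = 0 := fun y => by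
        rw [hu, Pi.sub_apply, extendTail_tailPos, LinearMap.funLeft_apply, sub_self]
      funext y
      rw [LinearMap.sub_apply, Pi.sub_apply, Matrix.toLin'_apply, Matrix.mulVec, dotProduct,
        sum_cons_pos]
      simp only [hu0, mul_zero, Finset.sum_const_zero, add_zero, blockNormalForm_zero_col,
        LinearMap.smul_apply, Pi.smul_apply, Module.End.one_apply, smul_eq_mul, Pi.zero_apply]
      rcases eq_headPos_or_eq_tailPos x l y with ⟨b, rfl⟩ | ⟨z, rfl⟩
      · rw [Finset.sum_eq_single b]
        · simp
        · intro c _ hc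
          rw [if_neg, zero_mul]
          exact fun h => hc (headPos_injective x l h).symm
        · simp
      · simp only [hu0, mul_zero, sub_zero]
        exact Finset.sum_eq_zero fun c _ => by rw [if_neg (tailPos_ne_headPos x l z c), zero_mul]
    rw [map_sub, sub_eq_zero] at h
    rw [LinearMap.comp_apply, ← h]
    simp
  eq_right u := by
    funext y
    rw [Pi.add_apply, LinearMap.funLeft_apply, LinearMap.comp_apply, LinearMap.sub_apply,
      Pi.sub_apply, blockNormalForm_apply_extendTail, LinearMap.smul_apply, Pi.smul_apply,
      Module.End.one_apply]
    change _ = x.1 * u y + (_ - x.1 * u y)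
    ring

theorem hasKernelDims_blockNormalForm (l : List (ℂ × ℕ))
    (hl : l.Pairwise fun a b => b.2 ≤ a.2) :
    HasKernelDims (Matrix.toLin' (blockNormalForm l)) l := by
  induction l with
  | nil =>
    have h : Module.finrank ℂ ((Σ i : Fin ([] : List (ℂ × ℕ)).length,
      Fin (([] : List (ℂ × ℕ)).get i).2) → ℂ) = 0 := by simp
    have := Module.finrank_zero_iff.1 h
    exact ⟨h, fun b k => by
      rw [multiplicities_nil, List.take_nil, List.sum_nil, Module.finrank_zero_iff]
      infer_instance⟩
  | cons x l ih =>
    rw [(blockNormalForm_isReduction x l hl).hasKernelDims_iff]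
    refine ⟨ih (List.pairwise_cons.1 hl).2, ?_⟩
    rw [Module.finrank_fintype_fun_eq_card, Module.finrank_fintype_fun_eq_card, Fintype.card_sigma,
      Fintype.card_sigma]
    simp only [Fintype.card_fin]
    exact Fin.sum_univ_succ _

/-! ### Spectral data in terms of kernel dimensions -/

section SpectralData

variable {V : Type*} [AddCommGroup V] [Module ℂ V] {W : Type*} [AddCommGroup W] [Module ℂ W]

theorem HasKernelDims.congr {f : Module.End ℂ V} {l l' : List (ℂ × ℕ)} (h : HasKernelDims f l)
    (hs : (l.map Prod.snd).sum = (l'.map Prod.snd).sum)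
    (hm : ∀ b, multiplicities l b = multiplicities l' b) : HasKernelDims f l' :=
  ⟨h.1.trans hs, fun b k => by rw [h.2, hm]⟩

theorem HasKernelDims.of_equiv {f : Module.End ℂ V} {g : Module.End ℂ W} {l : List (ℂ × ℕ)}
    (h : HasKernelDims f l) (e : V ≃ₗ[ℂ] W) (he : ∀ v, e (f v) = g (e v)) :
    HasKernelDims g l := by
  refine ⟨e.finrank_eq.symm.trans h.1, fun b k => ?_⟩
  have hk : ∀ (k : ℕ) v, e (((f - b • 1) ^ k) v) = ((g - b • 1) ^ k) (e v) := by
    intro k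
    induction k with
    | zero => simp
    | succ k ih =>
      intro v
      rw [pow_succ, pow_succ, Module.End.mul_apply, Module.End.mul_apply, ih]
      congr 1
      simp [he]
  rw [← h.2]
  refine (LinearEquiv.ofSubmodules e _ _ ?_).finrank_eq.symm
  ext w
  simp only [Submodule.mem_map, LinearMap.mem_ker]
  constructor
  · rintro ⟨v, hv, rfl⟩
    change ((g - b • 1) ^ k) (e v) = 0
    rw [← hk, hv, map_zero]
  · intro hw
    refine ⟨e.symm w, ?_, by simp⟩
    rw [← e.map_eq_zero_iff, hk]
    simpa using hw

theorem HasSpectralData.finiteDimensional {f : Module.End ℂ V} {l : List (ℂ × ℕ)}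
    (h : HasSpectralData f l) : FiniteDimensional ℂ V := by
  obtain ⟨l', -, -, b, -⟩ := h
  exact b.finiteDimensional_of_finite

theorem HasSpectralData.of_equiv {f : Module.End ℂ V} {g : Module.End ℂ W} {l : List (ℂ × ℕ)}
    (h : HasSpectralData f l) (e : V ≃ₗ[ℂ] W) (he : ∀ v, e (f v) = g (e v)) :
    HasSpectralData g l := by
  obtain ⟨l', hp, hl, b, hb⟩ := h
  refine ⟨l', hp, hl, b.map e, ?_⟩
  rw [← hb]
  ext i j
  simp [LinearMap.toMatrix_apply, ← he]

theorem HasSpectralData.perm {f : Module.End ℂ V} {l l₁ : List (ℂ × ℕ)}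
    (h : HasSpectralData f l) (hp : l.Perm l₁) : HasSpectralData f l₁ := by
  obtain ⟨l', hp', h⟩ := h
  exact ⟨l', hp'.trans hp, h⟩

/-- Kernel dimensions see the order of the list only within one eigenvalue, so this weaker
sortedness is what is recorded; `HasKernelDims.hasSpectralData` is the converse. -/
theorem HasSpectralData.exists_sorted {f : Module.End ℂ V} {l : List (ℂ × ℕ)}
    (h : HasSpectralData f l) :
    ∃ l' : List (ℂ × ℕ), l'.Perm l ∧ (∀ b, (multiplicities l' b).Pairwise (· ≥ ·)) ∧
      HasKernelDims f l' := by
  obtain ⟨l', hp, hl, b, hb⟩ := h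
  refine ⟨l', hp, hl.multiplicities, ?_⟩
  refine (hasKernelDims_blockNormalForm l' hl).of_equiv b.equivFun.symm fun u => ?_
  rw [← b.equivFun.injective.eq_iff, LinearEquiv.apply_symm_apply]
  have := LinearMap.toMatrix_mulVec_repr b b f (b.equivFun.symm u)
  rw [hb] at this
  rw [Matrix.toLin'_apply, Module.Basis.equivFun_apply, ← this]
  congr 1
  exact (b.equivFun.apply_symm_apply u).symm

theorem multiplicities_eq_of_perm {l l' : List (ℂ × ℕ)} (hp : l.Perm l') {b : ℂ}
    (h : (multiplicities l b).Pairwise (· ≥ ·)) (h' : (multiplicities l' b).Pairwise (· ≥ ·)) :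
    multiplicities l b = multiplicities l' b :=
  (hp.multiplicities b).eq_of_pairwise (fun _ _ _ _ h1 h2 => le_antisymm h2 h1) h h'

theorem exists_sorted_perm (l : List (ℂ × ℕ)) :
    ∃ l' : List (ℂ × ℕ), l'.Perm l ∧ l'.Pairwise fun a b => b.2 ≤ a.2 := by
  refine ⟨l.mergeSort fun a b => decide (b.2 ≤ a.2), List.mergeSort_perm _ _, ?_⟩
  refine (List.pairwise_mergeSort ?_ ?_ l).imp fun h => of_decide_eq_true h
  · intro a b c h1 h2
    simp only [decide_eq_true_eq] at *
    omega
  · intro a b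
    simp only [Bool.or_eq_true, decide_eq_true_eq]
    omega

theorem HasKernelDims.hasSpectralData [FiniteDimensional ℂ V] {f : Module.End ℂ V}
    {l : List (ℂ × ℕ)} (h : HasKernelDims f l)
    (hl : ∀ b, (multiplicities l b).Pairwise (· ≥ ·)) : HasSpectralData f l := by
  obtain ⟨l', hp, hs⟩ := exists_sorted_perm l
  have h' : HasKernelDims f l' := h.congr (hp.symm.map _).sum_eq fun b =>
    multiplicities_eq_of_perm hp.symm (hl b) (hs.multiplicities b)
  obtain ⟨e, he⟩ := (hasKernelDims_blockNormalForm l' hs).exists_equiv h'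
  refine HasSpectralData.of_equiv (f := Matrix.toLin' (blockNormalForm l')) ?_ e he
  exact ⟨l', hp, hs, Pi.basisFun ℂ _, by
    rw [← Matrix.toLin_eq_toLin', LinearMap.toMatrix_toLin]⟩

theorem HasSpectralData.add_smul {f : Module.End ℂ V} {l : List (ℂ × ℕ)}
    (h : HasSpectralData f l) (c : ℂ) :
    HasSpectralData (f + c • 1) (l.map fun x => (x.1 + c, x.2)) := by
  have := h.finiteDimensional
  obtain ⟨l', hp, hl, hk⟩ := h.exists_sorted
  refine HasSpectralData.perm (l := l'.map fun x => (x.1 + c, x.2)) ?_ (hp.map _)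
  refine HasKernelDims.hasSpectralData ⟨?_, fun b k => ?_⟩ fun b => ?_
  · rw [hk.1, List.map_map]
    rfl
  · rw [multiplicities_map_add, ← hk.2,
      show f + c • 1 - b • 1 = f - (b - c) • (1 : Module.End ℂ V) by module]
  · rw [multiplicities_map_add]
    exact hl _

namespace IsReduction

variable {U : Type*} [AddCommGroup U] [Module ℂ U] {a : ℂ} {f : Module.End ℂ V}
  {h : Module.End ℂ U} {i : U →ₗ[ℂ] V} {s : V →ₗ[ℂ] U}

/-- Prepending `m` keeps the order: `m` is the dimension of ker (f - a), which contains a copy of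
ker (h - a), and the latter has the largest multiplicity of `a` in the list as its dimension. -/
theorem hasSpectralData_cons [FiniteDimensional ℂ V] (H : IsReduction a f h i s) {m : ℕ}
    (hm : Module.finrank ℂ V = m + Module.finrank ℂ U) {l : List (ℂ × ℕ)}
    (hl : HasSpectralData h l) : HasSpectralData f ((a, m) :: l) := by
  have := hl.finiteDimensional
  obtain ⟨l', hp, hs, hk⟩ := hl.exists_sorted
  refine HasSpectralData.perm (l := (a, m) :: l') ?_ (hp.cons _)
  refine HasKernelDims.hasSpectralData ((H.hasKernelDims_iff m l').2 ⟨hk, hm⟩) fun b => ?_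
  rw [multiplicities_cons]
  split_ifs with hb
  · refine List.pairwise_cons.2 ⟨fun x hx => ?_, hs b⟩
    subst hb
    refine (le_sum_take_one (hs a) hx).trans ?_
    rw [← hk.2]
    have h1 := H.finrank_ker
    have h2 : Module.finrank ℂ (LinearMap.ker ((h - a • 1) ^ 1)) ≤
        Module.finrank ℂ (LinearMap.ker (f - a • 1)) := by
      refine LinearMap.finrank_le_finrank_of_injective
        (f := i.restrict (p := LinearMap.ker ((h - a • 1) ^ 1))
          (q := LinearMap.ker (f - a • 1)) fun v hv => ?_) ?_
      · rw [LinearMap.mem_ker] at hv ⊢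
        rw [← pow_one (f - a • 1), ← H.pow_comp_i, hv, map_zero]
      · rintro ⟨v, hv⟩ ⟨w, hw⟩ h0
        exact Subtype.ext (H.inj (congrArg Subtype.val h0))
    omega
  · exact hs b

/-- By the dimension hypothesis `m` is the dimension of ker (f - a), hence the largest multiplicity
of `a`; it may stand first in a list sorted within each eigenvalue. -/
theorem hasSpectralData_of_cons (H : IsReduction a f h i s) {m : ℕ}
    (hm : Module.finrank ℂ V = m + Module.finrank ℂ U) {l : List (ℂ × ℕ)}
    (hl : HasSpectralData f ((a, m) :: l)) : HasSpectralData h l := by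
  have := hl.finiteDimensional
  have : FiniteDimensional ℂ U := Module.Finite.of_surjective s H.surj
  obtain ⟨l', hp, hs, hk⟩ := hl.exists_sorted
  obtain ⟨l₁, hp₁, hs₁⟩ := exists_sorted_perm l
  have hp' : l'.Perm ((a, m) :: l₁) := hp.trans (hp₁.symm.cons _)
  have hs' : ∀ b, (multiplicities ((a, m) :: l₁) b).Pairwise (· ≥ ·) := by
    intro b
    have h1 := hp'.multiplicities b
    rw [multiplicities_cons] at h1 ⊢
    split_ifs at h1 ⊢ with hb
    · subst hb
      refine List.pairwise_cons.2 ⟨fun x hx => ?_, hs₁.multiplicities a⟩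
      refine (le_sum_take_one (hs a) (h1.mem_iff.2 (List.mem_cons_of_mem _ hx))).trans ?_
      rw [← hk.2, pow_one]
      have := H.finrank_ker
      omega
    · exact hs₁.multiplicities b
  have hk' : HasKernelDims f ((a, m) :: l₁) := hk.congr (hp'.map _).sum_eq fun b =>
    multiplicities_eq_of_perm hp' (hs b) (hs' b)
  exact (((H.hasKernelDims_iff m l₁).1 hk').1.hasSpectralData hs₁.multiplicities).perm hp₁

end IsReduction

end SpectralData

/-! ### Conjugacy of tuples -/

section TupleEquiv

variable {p : ℕ} {V W U : Type*} [AddCommGroup V] [Module ℂ V] [AddCommGroup W] [Module ℂ W]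
  [AddCommGroup U] [Module ℂ U]

theorem TupleEquiv.symm {A : Fin p → Module.End ℂ V} {B : Fin p → Module.End ℂ W}
    (h : TupleEquiv A B) : TupleEquiv B A := by
  obtain ⟨e, he⟩ := h
  refine ⟨e.symm, fun j w => ?_⟩
  rw [LinearEquiv.symm_apply_eq, he, LinearEquiv.apply_symm_apply]

theorem TupleEquiv.trans {A : Fin p → Module.End ℂ V} {B : Fin p → Module.End ℂ W}
    {C : Fin p → Module.End ℂ U} (h : TupleEquiv A B) (h' : TupleEquiv B C) :
    TupleEquiv A C := by
  obtain ⟨e, he⟩ := h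
  obtain ⟨e', he'⟩ := h'
  exact ⟨e ≪≫ₗ e', fun j v => by simp [he, he']⟩

theorem TupleEquiv.addition {A : Fin p → Module.End ℂ V} {B : Fin p → Module.End ℂ W}
    (h : TupleEquiv A B) (a : Fin p → ℂ) : TupleEquiv (addition a A) (addition a B) := by
  obtain ⟨e, he⟩ := h
  exact ⟨e, fun j v => by simp [_root_.addition, he]⟩

theorem TupleEquiv.swapInfinity {A : Fin p → Module.End ℂ V} {B : Fin p → Module.End ℂ W}
    (h : TupleEquiv A B) (i : Fin p) : TupleEquiv (swapInfinity i A) (swapInfinity i B) := by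
  obtain ⟨e, he⟩ := h
  refine ⟨e, fun j v => ?_⟩
  by_cases hj : j = i
  · subst hj
    simp [_root_.swapInfinity, he]
  · simp [_root_.swapInfinity, hj, he]

@[simp]
theorem appendZero_castSucc (A : Fin p → Module.End ℂ V) (j : Fin p) :
    appendZero A j.castSucc = A j := by
  simp [appendZero]

@[simp]
theorem appendZero_last (A : Fin p → Module.End ℂ V) : appendZero A (Fin.last p) = 0 := by
  simp [appendZero]

theorem TupleEquiv.appendZero {A : Fin p → Module.End ℂ V} {B : Fin p → Module.End ℂ W}
    (h : TupleEquiv A B) : TupleEquiv (appendZero A) (appendZero B) := by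
  obtain ⟨e, he⟩ := h
  refine ⟨e, fun j v => ?_⟩
  refine Fin.lastCases ?_ (fun j => ?_) j
  · simp
  · simp [he]

theorem mem_convK {A : Fin p → Module.End ℂ V} {u : Fin p → V} :
    u ∈ convK A ↔ ∀ j, A j (u j) = 0 := by
  simp [convK, Submodule.mem_pi]

theorem sum_convMap_apply (c : ℂ) (A : Fin p → Module.End ℂ V) (u : Fin p → V) (j : Fin p) :
    (∑ i, convMap c A i) u j = ∑ i, A i (u i) + c • u j := by
  simp only [LinearMap.sum_apply, Finset.sum_apply, convMap_apply]
  rw [Finset.sum_eq_single j (fun i _ hij => by simp [Pi.single_eq_of_ne hij.symm]) (by simp)]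
  simp

theorem mem_convL {c : ℂ} {A : Fin p → Module.End ℂ V} {u : Fin p → V} :
    u ∈ convL c A ↔ ∀ j, ∑ i, A i (u i) + c • u j = 0 := by
  rw [convL, LinearMap.mem_ker, funext_iff]
  simp only [sum_convMap_apply, Pi.zero_apply]

theorem TupleEquiv.mc {A : Fin p → Module.End ℂ V} {B : Fin p → Module.End ℂ W}
    (h : TupleEquiv A B) (c : ℂ) : TupleEquiv (mc c A) (mc c B) := by
  obtain ⟨e, he⟩ := h
  let E : (Fin p → V) ≃ₗ[ℂ] (Fin p → W) := LinearEquiv.piCongrRight fun _ => e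
  have hE : ∀ u j, E u j = e (u j) := fun _ _ => rfl
  have hK : (convK A).map (E : (Fin p → V) →ₗ[ℂ] (Fin p → W)) = convK B := by
    rw [Submodule.map_equiv_eq_comap_symm]
    ext w
    obtain ⟨u, rfl⟩ := E.surjective w
    simp [mem_convK, hE, ← he]
  have hL : (convL c A).map (E : (Fin p → V) →ₗ[ℂ] (Fin p → W)) = convL c B := by
    rw [Submodule.map_equiv_eq_comap_symm]
    ext w
    obtain ⟨u, rfl⟩ := E.surjective w
    simp [mem_convL, hE, ← he, ← map_sum, ← map_smul, ← map_add]
  refine ⟨Submodule.Quotient.equiv _ _ E (by rw [Submodule.map_sup, hK, hL]), fun j v => ?_⟩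
  obtain ⟨u, rfl⟩ := Submodule.Quotient.mk_surjective _ v
  simp only [_root_.mc, Submodule.mapQ_apply, Submodule.Quotient.equiv_apply]
  congr 1
  funext i
  change E _ i = _
  rw [hE, convMap_apply, convMap_apply]
  by_cases hi : i = j
  · subst hi
    simp [he, hE]
  · simp [hi]

/-- A map out of `V^p` with kernel `𝒦 + ℒ_c` computes the middle convolution. -/
theorem tupleEquiv_mc_of_ker {c : ℂ} {A : Fin p → Module.End ℂ V} {B : Fin p → Module.End ℂ W}
    (Φ : (Fin p → V) →ₗ[ℂ] W) (hsurj : Function.Surjective Φ)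
    (hker : LinearMap.ker Φ = convK A ⊔ convL c A)
    (hΦ : ∀ j u, Φ (convMap c A j u) = B j (Φ u)) : TupleEquiv (mc c A) B := by
  refine ⟨Submodule.quotEquivOfEq _ _ hker.symm ≪≫ₗ Φ.quotKerEquivOfSurjective hsurj,
    fun j v => ?_⟩
  obtain ⟨u, rfl⟩ := Submodule.Quotient.mk_surjective _ v
  exact hΦ j u

/-- If the sum of the resulting tuple is injective, then `ℒ_c ≤ 𝒦`. -/
theorem tupleEquiv_mc_of_injective {c : ℂ} {A : Fin p → Module.End ℂ V}
    {B : Fin p → Module.End ℂ W} (Φ : (Fin p → V) →ₗ[ℂ] W) (hsurj : Function.Surjective Φ)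
    (hker : ∀ u, Φ u = 0 ↔ ∀ j, A j (u j) = 0)
    (hΦ : ∀ j u, Φ (convMap c A j u) = B j (Φ u)) (hB : ∀ w, ∑ j, B j w = 0 → w = 0) :
    TupleEquiv (mc c A) B := by
  refine tupleEquiv_mc_of_ker Φ hsurj ?_ hΦ
  have hK : LinearMap.ker Φ = convK A := by
    ext u
    rw [LinearMap.mem_ker, hker, mem_convK]
  rw [hK, eq_comm, sup_eq_left, ← hK]
  -- Applying `Φ` to the vanishing sum of the G_j u gives a zero of the injective sum of the B_j.
  intro u hu
  refine hB _ ?_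
  rw [convL, LinearMap.mem_ker, LinearMap.sum_apply] at hu
  simp only [← hΦ, ← map_sum, hu, map_zero]

theorem TupleIrreducible.of_equiv {A : Fin p → Module.End ℂ V} {B : Fin p → Module.End ℂ W}
    (hA : TupleIrreducible A) (h : TupleEquiv A B) : TupleIrreducible B := by
  obtain ⟨e, he⟩ := h
  intro S hS
  rcases hA (S.comap (e : V →ₗ[ℂ] W)) (fun j v hv => by
    change e (A j v) ∈ S
    rw [he]
    exact hS j _ hv) with h0 | h1
  · left
    rw [eq_bot_iff]
    intro w hw
    have : e.symm w ∈ S.comap (e : V →ₗ[ℂ] W) := by simpa using hw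
    rw [h0, Submodule.mem_bot] at this
    simpa using this
  · right
    rw [eq_top_iff]
    intro w _
    have : e.symm w ∈ S.comap (e : V →ₗ[ℂ] W) := h1 ▸ Submodule.mem_top
    simpa using this

end TupleEquiv

theorem LinearMap.exists_comp_eq_of_range_le {K Z U V : Type*} [Field K] [AddCommGroup Z]
    [Module K Z] [AddCommGroup U] [Module K U] [AddCommGroup V] [Module K V] {X : U →ₗ[K] V}
    (hX : Function.Injective X) (g : Z →ₗ[K] V) (h : ∀ z, g z ∈ LinearMap.range X) :
    ∃ s : Z →ₗ[K] U, ∀ z, X (s z) = g z := by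
  refine ⟨(LinearEquiv.ofInjective X hX).symm.toLinearMap ∘ₗ
    LinearMap.codRestrict (LinearMap.range X) g h, fun z => ?_⟩
  have := congrArg Subtype.val ((LinearEquiv.ofInjective X hX).apply_symm_apply
    (LinearMap.codRestrict (LinearMap.range X) g h z))
  rwa [LinearEquiv.ofInjective_apply] at this

/-! ### Okubo tuples attached to a grading -/

section Okubo

variable {p : ℕ} {V U : Type*} [AddCommGroup V] [Module ℂ V] [AddCommGroup U] [Module ℂ U]
  {P : Fin p → Module.End ℂ V} {A : Module.End ℂ V}

/-- The tuple of the block rows of `A` with respect to a family of projections. -/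
def okubo (P : Fin p → Module.End ℂ V) (A : Module.End ℂ V) : Fin p → Module.End ℂ V :=
  fun j => P j * A

theorem okubo_apply (P : Fin p → Module.End ℂ V) (A : Module.End ℂ V) (j : Fin p) (v : V) :
    okubo P A j v = P j (A v) := rfl

theorem CompleteOrthogonalIdempotents.apply_self (hP : CompleteOrthogonalIdempotents P)
    (j : Fin p) (v : V) : P j (P j v) = P j v :=
  LinearMap.congr_fun (hP.idem j) v

theorem CompleteOrthogonalIdempotents.apply_of_ne (hP : CompleteOrthogonalIdempotents P)
    {i j : Fin p} (h : i ≠ j) (v : V) : P i (P j v) = 0 :=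
  LinearMap.congr_fun (hP.ortho h) v

theorem CompleteOrthogonalIdempotents.sum_apply (hP : CompleteOrthogonalIdempotents P)
    (v : V) : ∑ j, P j v = v := by
  have := LinearMap.congr_fun hP.complete v
  simpa using this

theorem CompleteOrthogonalIdempotents.apply_sum (hP : CompleteOrthogonalIdempotents P)
    (j : Fin p) (u : Fin p → V) : P j (∑ i, P i (u i)) = P j (u j) := by
  rw [map_sum, Finset.sum_eq_single j (fun i _ hij => hP.apply_of_ne hij.symm _) (by simp),
    hP.apply_self]

theorem sum_okubo (hP : CompleteOrthogonalIdempotents P) (v : V) :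
    ∑ j, okubo P A j v = A v :=
  hP.sum_apply (A v)

/-- The tuple induced by `R ∘ P_j` on the image of `R`. -/
def rangeTuple (R : Module.End ℂ V) (P : Fin p → Module.End ℂ V) :
    Fin p → Module.End ℂ (LinearMap.range R) :=
  fun j => R.rangeRestrict ∘ₗ P j ∘ₗ (LinearMap.range R).subtype

theorem rangeTuple_coe (R : Module.End ℂ V) (P : Fin p → Module.End ℂ V) (j : Fin p)
    (z : LinearMap.range R) : (rangeTuple R P j z : V) = R (P j z) := rfl

theorem sum_rangeTuple_coe (hP : CompleteOrthogonalIdempotents P) (R : Module.End ℂ V)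
    (z : LinearMap.range R) : ((∑ j, rangeTuple R P j z : LinearMap.range R) : V) = R z := by
  rw [AddSubmonoidClass.coe_finsetSum]
  simp only [rangeTuple_coe]
  rw [← map_sum, hP.sum_apply]

/-- The middle convolution `mc_{-μ}` of an Okubo tuple lives on the image of `A - μ`. -/
theorem mc_okubo (hP : CompleteOrthogonalIdempotents P) (hA : Function.Bijective A) {μ : ℂ}
    (hμ : μ ≠ 0) : TupleEquiv (mc (-μ) (okubo P A)) (rangeTuple (A - μ • 1) P) := by
  -- `σ` has kernel 𝒦 because the blocks are independent, and it turns G_j into P_j (A - μ). It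
  -- sends ℒ onto ker (A - μ), so the quotient is V / ker (A - μ), that is, the range of A - μ.
  let σ : (Fin p → V) →ₗ[ℂ] V := ∑ j, okubo P A j ∘ₗ LinearMap.proj j
  have hσ : ∀ u, σ u = ∑ j, P j (A (u j)) := fun u => by simp [σ, okubo_apply]
  have hσc : ∀ v, σ (fun _ => v) = A v := fun v => by rw [hσ, hP.sum_apply]
  refine tupleEquiv_mc_of_ker ((A - μ • 1).rangeRestrict ∘ₗ σ) ?_ ?_ ?_
  · rw [LinearMap.coe_comp]
    refine (LinearMap.surjective_rangeRestrict _).comp fun v => ?_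
    obtain ⟨w, rfl⟩ := hA.2 v
    exact ⟨fun _ => w, hσc w⟩
  · apply le_antisymm
    · intro u hu
      have hu' : A (σ u) = μ • σ u := by
        have := congrArg Subtype.val hu
        simpa [sub_eq_zero] using this
      -- Elements of ℒ are constant tuples as μ ≠ 0, and `σ` sends the constant tuple v to A v; this
      -- dictates the ℒ-part of `u`.
      have h1 : (fun _ => μ⁻¹ • σ u) ∈ convL (-μ) (okubo P A) := by
        rw [mem_convL]
        intro j
        rw [sum_okubo hP, map_smul, hu', smul_smul, smul_smul, inv_mul_cancel₀ hμ, neg_mul,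
          mul_inv_cancel₀ hμ, neg_smul, add_neg_cancel]
      have h2 : u - (fun _ => μ⁻¹ • σ u) ∈ convK (okubo P A) := by
        rw [mem_convK]
        intro j
        have h3 : σ (u - fun _ => μ⁻¹ • σ u) = 0 := by
          rw [map_sub, hσc, map_smul, hu', smul_smul, inv_mul_cancel₀ hμ, one_smul, sub_self]
        have h4 := hP.apply_sum j fun i => A ((u - (fun _ => μ⁻¹ • σ u) : Fin p → V) i)
        rw [← hσ, h3, map_zero] at h4
        exact h4.symm
      exact Submodule.mem_sup.2 ⟨_, h2, _, h1, sub_add_cancel _ _⟩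
    · refine sup_le (fun u hu => ?_) fun u hu => ?_
      · rw [mem_convK] at hu
        have : σ u = 0 := by
          rw [hσ]
          exact Finset.sum_eq_zero fun j _ => hu j
        rw [LinearMap.mem_ker, LinearMap.comp_apply, this, map_zero]
      · rw [mem_convL] at hu
        have h1 : ∀ j, σ u = μ • u j := by
          intro j
          have := hu j
          rw [neg_smul, ← sub_eq_add_neg, sub_eq_zero] at this
          rw [← this, hσ]
          rfl
        have h2 : u = fun _ => μ⁻¹ • σ u := by
          funext j
          rw [h1 j, smul_smul, inv_mul_cancel₀ hμ, one_smul]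
        have h3 : A (σ u) = μ • σ u := by
          have h4 := hσc (μ⁻¹ • σ u)
          rw [← h2, map_smul] at h4
          rw [h4, smul_smul, mul_inv_cancel₀ hμ, one_smul, ← h4]
        refine Subtype.ext ?_
        simp [h3]
  · intro j u
    refine Subtype.ext ?_
    have h1 : σ (convMap (-μ) (okubo P A) j u) = P j ((A - μ • 1) (σ u)) := by
      rw [hσ, Finset.sum_eq_single j (fun i _ hij => by
        rw [convMap_apply, Pi.single_eq_of_ne hij, map_zero, map_zero]) (by simp), convMap_apply,
        Pi.single_eq_same]
      have h2 : ∑ i, okubo P A i (u i) = σ u := (hσ u).symm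
      have h3 : P j (σ u) = P j (A (u j)) := by rw [hσ, hP.apply_sum]
      rw [h2]
      simp [h3, sub_eq_add_neg]
    rw [rangeTuple_coe, LinearMap.comp_apply, h1]
    rfl

/-- In an irreducible Okubo tuple, `A - μ ≠ 0` is injective on the blocks and its block rows are
surjective. -/
theorem TupleIrreducible.block_injective_surjective (hP : CompleteOrthogonalIdempotents P)
    (hirr : TupleIrreducible (okubo P A)) {μ : ℂ} (hR : A - μ • 1 ≠ 0) :
    (∀ j v, (A - μ • 1) (P j v) = 0 → P j v = 0) ∧
      ∀ j v, ∃ w, P j ((A - μ • 1) w) = P j v := by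
  constructor
  · intro j v hv
    have hv' : A (P j v) = μ • P j v := by simpa [sub_eq_zero] using hv
    -- A block vector killed by A - μ spans an invariant line; were it the whole space, A would be
    -- μ.
    rcases hirr (Submodule.span ℂ {P j v}) (fun i w hw => by
      obtain ⟨c, rfl⟩ := Submodule.mem_span_singleton.1 hw
      rw [okubo_apply, map_smul, hv', map_smul, map_smul]
      by_cases hij : i = j
      · subst hij
        rw [hP.apply_self]
        exact Submodule.smul_mem _ _ (Submodule.smul_mem _ _ (Submodule.mem_span_singleton_self _))
      · rw [hP.apply_of_ne hij, smul_zero, smul_zero]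
        exact Submodule.zero_mem _) with h | h
    · exact Submodule.span_singleton_eq_bot.1 h
    · refine absurd (LinearMap.ext fun w => ?_) hR
      obtain ⟨c, rfl⟩ := Submodule.mem_span_singleton.1 (h ▸ Submodule.mem_top : w ∈ _)
      rw [map_smul, hv, smul_zero, LinearMap.zero_apply]
  · intro j
    -- `S` contains the other blocks and the range of A - μ, and is invariant since P_j A w = P_j (A
    -- - μ) w + μ P_j w. So S = 0 would force A = μ.
    let S : Submodule ℂ V := (LinearMap.range (P j * (A - μ • 1))).comap (P j)
    have hS : ∀ w, w ∈ S ↔ ∃ x, P j ((A - μ • 1) x) = P j w := fun w => Iff.rfl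
    rcases hirr S (fun i w hw => by
      by_cases hij : j = i
      · subst hij
        obtain ⟨x, hx⟩ := (hS w).1 hw
        refine (hS _).2 ⟨w + μ • x, ?_⟩
        rw [map_add, map_add, map_smul, map_smul, hx, okubo_apply, hP.apply_self]
        simp
      · refine (hS _).2 ⟨0, ?_⟩
        rw [okubo_apply, hP.apply_of_ne hij, map_zero, map_zero]) with h | h
    · refine absurd (LinearMap.ext fun w => ?_) hR
      have h1 : ∀ x, P j x = x := by
        intro x
        have : x - P j x ∈ S := (hS _).2 ⟨0, by
          rw [map_zero, map_zero, map_sub, hP.apply_self, sub_self]⟩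
        rw [h, Submodule.mem_bot, sub_eq_zero] at this
        exact this.symm
      have h2 : (A - μ • 1) w ∈ S := (hS _).2 ⟨w, rfl⟩
      rw [h, Submodule.mem_bot] at h2
      exact h2
    · exact fun v => (hS v).1 (h ▸ Submodule.mem_top)

/-! ### Adding one block -/

/-- The endomorphism with block matrix `(A, X; Y, D)`. -/
def blockMap (A : Module.End ℂ V) (X : U →ₗ[ℂ] V) (Y : V →ₗ[ℂ] U) (D : Module.End ℂ U) :
    Module.End ℂ (V × U) :=
  (A.coprod X).prod (Y.coprod D)

@[simp]
theorem blockMap_apply (A : Module.End ℂ V) (X : U →ₗ[ℂ] V) (Y : V →ₗ[ℂ] U) (D : Module.End ℂ U)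
    (v : V × U) : blockMap A X Y D v = (A v.1 + X v.2, Y v.1 + D v.2) := rfl

/-- The projections onto the blocks after `U` has been added as the last block. -/
def blockProj (U : Type*) [AddCommGroup U] [Module ℂ U] (P : Fin p → Module.End ℂ V) :
    Fin (p + 1) → Module.End ℂ (V × U) :=
  Fin.snoc (α := fun _ => Module.End ℂ (V × U)) (fun j => LinearMap.prodMap (P j) 0)
    (LinearMap.prodMap 0 LinearMap.id)

@[simp]
theorem blockProj_castSucc (P : Fin p → Module.End ℂ V) (j : Fin p) (v : V × U) :
    blockProj U P j.castSucc v = (P j v.1, 0) := by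
  simp [blockProj]

@[simp]
theorem blockProj_last (P : Fin p → Module.End ℂ V) (v : V × U) :
    blockProj U P (Fin.last p) v = (0, v.2) := by
  simp [blockProj]

theorem CompleteOrthogonalIdempotents.blockProj (hP : CompleteOrthogonalIdempotents P) :
    CompleteOrthogonalIdempotents (blockProj U P) := by
  rw [CompleteOrthogonalIdempotents.iff_ortho_complete]
  constructor
  · intro i j hij
    refine LinearMap.ext fun v => ?_
    rw [Module.End.mul_apply]
    induction i using Fin.lastCases with
    | last =>
      induction j using Fin.lastCases with
      | last => exact absurd rfl hij
      | cast j => simp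
    | cast i =>
      induction j using Fin.lastCases with
      | last => simp
      | cast j =>
        have : i ≠ j := fun h => hij (congrArg _ h)
        simp [hP.apply_of_ne this]
  · refine LinearMap.ext fun v => ?_
    rw [LinearMap.sum_apply, Fin.sum_univ_castSucc]
    simp only [blockProj_castSucc, blockProj_last]
    refine Prod.ext ?_ ?_
    · simp [Prod.fst_sum, hP.sum_apply]
    · simp [Prod.snd_sum]

variable {X : U →ₗ[ℂ] V} {Y : V →ₗ[ℂ] U} {D : Module.End ℂ U} {μ₁ μ₂ : ℂ}

/-- The extending operation adds one block to an Okubo tuple. -/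
theorem extendingOp_okubo (hP : CompleteOrthogonalIdempotents P) (hA : Function.Bijective A)
    (hμ₁ : μ₁ ≠ 0)
    (hRinj : ∀ j v, (A - μ₁ • 1) (P j v) = 0 → P j v = 0)
    (hRsurj : ∀ j v, ∃ w, P j ((A - μ₁ • 1) w) = P j v)
    (hX : Function.Injective X) (hY : Function.Surjective Y)
    (hXY : ∀ v, X (Y v) = μ₂ • (A - μ₁ • 1) v - A ((A - μ₁ • 1) v))
    (hXD : ∀ u, X (D u) = (μ₁ + μ₂) • X u - A (X u))
    (hF : Function.Injective (blockMap A X Y D)) :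
    TupleEquiv (extendingOp μ₁ μ₂ (okubo P A)) (okubo (blockProj U P) (blockMap A X Y D)) := by
  refine TupleEquiv.trans (TupleEquiv.mc (TupleEquiv.addition (TupleEquiv.swapInfinity
    (TupleEquiv.appendZero (mc_okubo hP hA hμ₁)) _) _) _) ?_
  set R := A - μ₁ • 1 with hR
  have hRv : ∀ v, R v = A v - μ₁ • v := fun v => by simp [hR]
  set B := addition (Pi.single (Fin.last p) (μ₂ - μ₁))
    (swapInfinity (Fin.last p) (appendZero (rangeTuple R P))) with hB
  have hBc : ∀ j z, (B (Fin.castSucc j) z : V) = R (P j z) := by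
    intro j z
    have : Fin.castSucc j ≠ Fin.last p := (Fin.castSucc_lt_last j).ne
    simp [hB, addition, swapInfinity, this, rangeTuple_coe]
  -- The residue at infinity is -R = μ₁ - A; the shift by μ₂ - μ₁ makes it μ₂ - A.
  have hBl : ∀ z, (B (Fin.last p) z : V) = μ₂ • (z : V) - A z := by
    intro z
    simp only [hB, addition, swapInfinity, Function.update_self, Pi.single_eq_same,
      Fin.sum_univ_castSucc, appendZero_castSucc, appendZero_last, add_zero, LinearMap.add_apply,
      LinearMap.neg_apply, LinearMap.sum_apply, LinearMap.smul_apply, LinearMap.id_apply,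
      Submodule.coe_add, Submodule.coe_neg, Submodule.coe_smul]
    rw [sum_rangeTuple_coe hP, hRv]
    module
  -- the map onto the last block
  have hmem : ∀ z : LinearMap.range R, μ₂ • (z : V) - A z ∈ LinearMap.range X := by
    rintro ⟨_, v, rfl⟩
    exact ⟨Y v, hXY v⟩
  obtain ⟨s, hs⟩ := LinearMap.exists_comp_eq_of_range_le hX
    ((μ₂ • 1 - A) ∘ₗ (LinearMap.range R).subtype) (fun z => by simpa using hmem z)
  have hXs : ∀ z : LinearMap.range R, X (s z) = μ₂ • (z : V) - A z := fun z => by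
    simpa using hs z
  have hsR : ∀ v, s ⟨R v, v, rfl⟩ = Y v := fun v => hX (by rw [hXs, hXY])
  have hrange : ∀ u, X u ∈ LinearMap.range R := by
    intro u
    obtain ⟨v, rfl⟩ := hY u
    refine ⟨μ₂ • v - A v, ?_⟩
    rw [hXY]
    simp only [hRv, map_sub, map_smul]
    module
  -- The relation for XD makes s X equal to D - μ₁; the parameter μ₁ of the second convolution
  -- restores `D`.
  have hsX : ∀ u, s ⟨X u, hrange u⟩ = D u - μ₁ • u := fun u => hX (by
    rw [hXs, map_sub, hXD, map_smul]
    module)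
  -- The first entries R P_j contribute the blocks P_j u_j, as `R` is injective on blocks; the last
  -- entry X s contributes `s` of the last component, as `X` is injective.
  let Φ : (Fin (p + 1) → LinearMap.range R) →ₗ[ℂ] V × U :=
    ((∑ j : Fin p, P j ∘ₗ (LinearMap.range R).subtype ∘ₗ LinearMap.proj j.castSucc)).prod
      (s ∘ₗ LinearMap.proj (Fin.last p))
  have hΦ : ∀ u, Φ u = (∑ j : Fin p, P j (u j.castSucc), s (u (Fin.last p))) := fun u => by
    simp [Φ]
  refine tupleEquiv_mc_of_injective Φ ?_ ?_ ?_ ?_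
  · rintro ⟨v, u⟩
    choose w hw using fun j => hRsurj j v
    obtain ⟨x, rfl⟩ := hY u
    refine ⟨Fin.snoc (α := fun _ => LinearMap.range R) (fun j => ⟨R (w j), w j, rfl⟩)
      ⟨R x, x, rfl⟩, ?_⟩
    rw [hΦ]
    simp only [Fin.snoc_castSucc, Fin.snoc_last, hw, hsR, hP.sum_apply]
  · intro u
    rw [hΦ, Prod.mk_eq_zero, Fin.forall_fin_succ']
    refine and_congr ⟨fun h j => ?_, fun h => ?_⟩ ?_
    · refine Subtype.ext ?_
      rw [hBc, ← hP.apply_sum j fun i => (u i.castSucc : V), h, map_zero, map_zero]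
      rfl
    · refine Finset.sum_eq_zero fun j _ => hRinj j _ ?_
      rw [← hBc, h j]
      rfl
    · rw [← map_eq_zero_iff X hX, hXs, ← hBl, ZeroMemClass.coe_eq_zero]
  · intro j u
    have hsum : ∑ i, (B i (u i) : V) = R (Φ u).1 + X (Φ u).2 := by
      rw [Fin.sum_univ_castSucc, hBl, ← hXs, hΦ, map_sum]
      simp only [hBc]
    induction j using Fin.lastCases with
    | last =>
      rw [okubo_apply, blockProj_last, blockMap_apply, hΦ (convMap _ _ _ _), convMap_apply]
      refine Prod.ext ?_ ?_
      · change ∑ i : Fin p, P i ((Pi.single (M := fun _ => LinearMap.range R) (Fin.last p) _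
          i.castSucc : LinearMap.range R) : V) = 0
        refine Finset.sum_eq_zero fun j _ => ?_
        rw [Pi.single_eq_of_ne (Fin.castSucc_lt_last j).ne]
        simp
      · change s (Pi.single (M := fun _ => LinearMap.range R) (Fin.last p) _ (Fin.last p)) = _
        rw [Pi.single_eq_same]
        have h1 : (∑ i, B i (u i)) + μ₁ • u (Fin.last p) =
            (⟨R (Φ u).1, _, rfl⟩ + ⟨X (Φ u).2, hrange _⟩ + μ₁ • u (Fin.last p) :
              LinearMap.range R) := by
          refine Subtype.ext ?_
          simp [hsum]
        rw [h1, map_add, map_add, hsR, hsX, map_smul]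
        have h2 : s (u (Fin.last p)) = (Φ u).2 := by rw [hΦ]
        rw [h2]
        change _ = Y (Φ u).1 + D (Φ u).2
        abel
    | cast j =>
      rw [okubo_apply, blockProj_castSucc, blockMap_apply, hΦ (convMap _ _ _ _), convMap_apply]
      refine Prod.ext ?_ ?_
      · change ∑ i : Fin p, P i ((Pi.single (M := fun _ => LinearMap.range R) j.castSucc _
          i.castSucc : LinearMap.range R) : V) = _
        rw [Finset.sum_eq_single j (fun i _ hij => by
          rw [Pi.single_eq_of_ne (fun h => hij (Fin.castSucc_injective p h))]
          simp) (by simp), Pi.single_eq_same]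
        rw [Submodule.coe_add, AddSubmonoidClass.coe_finsetSum, hsum, Submodule.coe_smul, hRv]
        have h2 : P j (Φ u).1 = P j (u j.castSucc) := by
          rw [hΦ]
          exact hP.apply_sum j fun i => (u i.castSucc : V)
        simp only [map_add, map_sub, map_smul, h2]
        abel
      · rw [Pi.single_eq_of_ne (Fin.castSucc_lt_last j).ne', map_zero]
  · intro w hw
    rw [sum_okubo hP.blockProj] at hw
    exact (map_eq_zero_iff _ hF).1 hw

/-- The restricting operation deletes the last block of an Okubo tuple. -/
theorem restrictingOp_okubo (hP : CompleteOrthogonalIdempotents P)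
    (hF : Function.Bijective (blockMap A X Y D)) (hμ₁ : μ₁ ≠ 0)
    (hRinj : ∀ j v, (blockMap A X Y D - μ₁ • 1) (blockProj U P j v) = 0 → blockProj U P j v = 0)
    (hRsurj : ∀ j v, ∃ w,
      blockProj U P j ((blockMap A X Y D - μ₁ • 1) w) = blockProj U P j v)
    (hFF : ∀ v, blockMap A X Y D ((blockMap A X Y D - μ₁ • 1) v) =
      μ₂ • (blockMap A X Y D - μ₁ • 1) v)
    (hA : Function.Injective A) :
    TupleEquiv (restrictingOp μ₁ μ₂ (okubo (blockProj U P) (blockMap A X Y D)))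
      (appendZero (okubo P A)) := by
  refine TupleEquiv.trans (TupleEquiv.mc (TupleEquiv.swapInfinity (TupleEquiv.addition
    (mc_okubo hP.blockProj hF hμ₁) _) _) _) ?_
  set F := blockMap A X Y D with hFdef
  set R := F - μ₁ • 1 with hR
  have hRv : ∀ v, R v = F v - μ₁ • v := fun v => by simp [hR]
  set C := swapInfinity (Fin.last p) (addition (Pi.single (Fin.last p) (μ₁ - μ₂))
    (rangeTuple R (blockProj U P))) with hC
  have hCc : ∀ j z, (C (Fin.castSucc j) z : V × U) = R (P j (z : V × U).1, 0) := by
    intro j z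
    have : Fin.castSucc j ≠ Fin.last p := (Fin.castSucc_lt_last j).ne
    simp [hC, addition, swapInfinity, this, rangeTuple_coe]
  -- The decisive cancellation: `F` is μ₂ on the range of `R`, so the tuple sums to μ₂ - μ₁ there,
  -- and the shift μ₁ - μ₂ makes the residue at infinity vanish.
  have hCl : ∀ z, C (Fin.last p) z = 0 := by
    rintro ⟨_, v, rfl⟩
    refine Subtype.ext ?_
    simp only [hC, swapInfinity, Function.update_self, addition, Finset.sum_add_distrib,
      LinearMap.neg_apply, LinearMap.add_apply, LinearMap.sum_apply, LinearMap.smul_apply,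
      LinearMap.id_apply, Submodule.coe_neg, Submodule.coe_add]
    rw [sum_rangeTuple_coe hP.blockProj, hRv (R v), hFF, ← Finset.sum_smul,
      Finset.sum_pi_single', if_pos (Finset.mem_univ _), Submodule.coe_smul]
    simp only [ZeroMemClass.coe_zero]
    module
  -- With last entry 0, the whole last component lies in 𝒦 and is forgotten.
  let Φ : (Fin (p + 1) → LinearMap.range R) →ₗ[ℂ] V :=
    ∑ j : Fin p, P j ∘ₗ LinearMap.fst ℂ V U ∘ₗ (LinearMap.range R).subtype ∘ₗ
      LinearMap.proj j.castSucc
  have hΦ : ∀ u, Φ u = ∑ j : Fin p, P j (u j.castSucc : V × U).1 := fun u => by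
    simp [Φ]
  refine tupleEquiv_mc_of_injective Φ ?_ ?_ ?_ ?_
  · intro v
    choose w hw using fun j => hRsurj (Fin.castSucc j) (v, 0)
    refine ⟨Fin.snoc (α := fun _ => LinearMap.range R) (fun j => ⟨R (w j), w j, rfl⟩) 0, ?_⟩
    rw [hΦ, ← hP.sum_apply v]
    refine Finset.sum_congr rfl fun j _ => ?_
    have := hw j
    rw [blockProj_castSucc, blockProj_castSucc] at this
    simpa using congrArg Prod.fst this
  · intro u
    rw [hΦ, Fin.forall_fin_succ']
    refine ⟨fun h => ⟨fun j => ?_, hCl _⟩, fun h => ?_⟩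
    · refine Subtype.ext ?_
      rw [hCc, ← hP.apply_sum j fun i => (u i.castSucc : V × U).1, h, map_zero]
      exact map_zero R
    · refine Finset.sum_eq_zero fun j _ => ?_
      have h1 := hRinj (Fin.castSucc j) (u j.castSucc : V × U) (by
        rw [blockProj_castSucc, ← hCc, h.1 j]
        rfl)
      rw [blockProj_castSucc] at h1
      exact congrArg Prod.fst h1
  · intro j u
    -- The first component of F (v, 0) is A v, and the parameter μ₁ cancels the -μ₁ in `R`; this is
    -- how `A` reappears.
    have hsum : ∑ i, (C i (u i) : V × U) = R (Φ u, 0) := by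
      rw [Fin.sum_univ_castSucc, hCl, hΦ]
      simp only [hCc]
      rw [ZeroMemClass.coe_zero, add_zero, ← map_sum]
      congr 1
      refine Prod.ext ?_ ?_
      · simp [Prod.fst_sum]
      · simp [Prod.snd_sum]
    induction j using Fin.lastCases with
    | last =>
      rw [appendZero_last, LinearMap.zero_apply, hΦ, convMap_apply]
      refine Finset.sum_eq_zero fun j _ => ?_
      rw [Pi.single_eq_of_ne (Fin.castSucc_lt_last j).ne]
      simp
    | cast j =>
      rw [appendZero_castSucc, okubo_apply, hΦ (convMap _ _ _ _), convMap_apply,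
        Finset.sum_eq_single j (fun i _ hij => by
          rw [Pi.single_eq_of_ne (fun h => hij (Fin.castSucc_injective p h))]
          simp) (by simp), Pi.single_eq_same]
      rw [Submodule.coe_add, AddSubmonoidClass.coe_finsetSum, hsum, Submodule.coe_smul, hRv]
      have h2 : P j (Φ u) = P j (u j.castSucc : V × U).1 := by
        rw [hΦ]
        exact hP.apply_sum j fun i => (u i.castSucc : V × U).1
      simp [hFdef, h2]
  · intro w hw
    rw [Fin.sum_univ_castSucc] at hw
    simp only [appendZero_castSucc, appendZero_last, LinearMap.zero_apply, add_zero] at hw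
    rw [sum_okubo hP] at hw
    exact (map_eq_zero_iff _ hA).1 hw

end Okubo

/-! ### Irreducible Okubo tuples whose matrix satisfies a quadratic equation -/

section Irreducible

variable {p : ℕ} {V U : Type*} [AddCommGroup V] [Module ℂ V] [AddCommGroup U] [Module ℂ U]
  {P : Fin p → Module.End ℂ V} {A : Module.End ℂ V} {X : U →ₗ[ℂ] V} {Y : V →ₗ[ℂ] U}
  {D : Module.End ℂ U} {c d : ℂ}

theorem TupleIrreducible.injective_of_ne_zero (hirr : TupleIrreducible (okubo P A)) (hA : A ≠ 0) :
    Function.Injective A := by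
  rcases hirr (LinearMap.ker A) (fun j v hv => by
    have hv' : A v = 0 := hv
    rw [okubo_apply, hv', map_zero]
    exact Submodule.zero_mem _) with h | h
  · exact LinearMap.ker_eq_bot.1 h
  · exact absurd (LinearMap.ker_eq_top.1 h) hA

theorem block_cases {T : Submodule ℂ (V × U)}
    (hirr : TupleIrreducible (okubo (blockProj U P) (blockMap A X Y D)))
    (h1 : ∀ j, ∀ v ∈ T, (P j (A v.1 + X v.2), (0 : U)) ∈ T)
    (h2 : ∀ v ∈ T, ((0 : V), Y v.1 + D v.2) ∈ T) : T = ⊥ ∨ T = ⊤ := by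
  refine hirr T fun j v hv => ?_
  rw [okubo_apply]
  induction j using Fin.lastCases with
  | last => simpa using h2 v hv
  | cast j => simpa using h1 j v hv

/-- Only F = 0 has to be excluded, and then V × 0 would be a proper nonzero invariant subspace. -/
theorem block_injective [Nontrivial V] [Nontrivial U]
    (hirr : TupleIrreducible (okubo (blockProj U P) (blockMap A X Y D))) :
    Function.Injective (blockMap A X Y D) := by
  refine hirr.injective_of_ne_zero fun h0 => ?_
  have h : ∀ v : V × U, A v.1 + X v.2 = 0 ∧ Y v.1 + D v.2 = 0 := fun v =>
    Prod.mk_eq_zero.1 (LinearMap.congr_fun h0 v)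
  rcases block_cases (T := Submodule.prod ⊤ ⊥) hirr (fun j v _ => by simp)
    (fun v _ => by simp [h v]) with h1 | h1
  · obtain ⟨v, hv⟩ := exists_ne (0 : V)
    have : ((v, 0) : V × U) ∈ Submodule.prod (⊤ : Submodule ℂ V) (⊥ : Submodule ℂ U) := by simp
    rw [h1] at this
    simp [hv] at this
  · obtain ⟨u, hu⟩ := exists_ne (0 : U)
    have : ((0, u) : V × U) ∈ Submodule.prod (⊤ : Submodule ℂ V) (⊥ : Submodule ℂ U) := by
      simp [h1]
    simp [hu] at this

/-- The quadratic equation `F² = c F - d` for a block matrix. -/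
theorem block_quadratic (hq : ∀ v, blockMap A X Y D (blockMap A X Y D v) =
    c • blockMap A X Y D v - d • v) :
    (∀ v, X (Y v) = c • A v - d • v - A (A v)) ∧ (∀ u, X (D u) = c • X u - A (X u)) ∧
      ∀ v, D (Y v) = c • Y v - Y (A v) := by
  refine ⟨fun v => ?_, fun u => ?_, fun v => ?_⟩
  · have := congrArg Prod.fst (hq (v, 0))
    simp only [blockMap_apply, map_zero, add_zero, Prod.fst_sub, Prod.smul_fst] at this
    rw [← this]
    abel
  · have := congrArg Prod.fst (hq (0, u))
    simp only [blockMap_apply, map_zero, zero_add, Prod.fst_sub, Prod.smul_fst, smul_zero,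
      sub_zero] at this
    rw [← this]
    abel
  · have := congrArg Prod.snd (hq (v, 0))
    simp only [blockMap_apply, map_zero, add_zero, Prod.snd_sub, Prod.smul_snd, smul_zero,
      sub_zero] at this
    rw [← this]
    abel

/-- XD = (c - A)X makes 0 × ker X invariant, and it is not everything. -/
theorem block_X_injective [Nontrivial V]
    (hirr : TupleIrreducible (okubo (blockProj U P) (blockMap A X Y D)))
    (hXD : ∀ u, X (D u) = c • X u - A (X u)) : Function.Injective X := by
  rcases block_cases (T := Submodule.prod ⊥ (LinearMap.ker X)) hirr (fun j v hv => by
      obtain ⟨h1, h2⟩ := hv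
      have h1' : v.1 = 0 := h1
      have h2' : X v.2 = 0 := h2
      simp [h1', h2'])
    (fun v hv => by
      obtain ⟨h1, h2⟩ := hv
      have h1' : v.1 = 0 := h1
      have h2' : X v.2 = 0 := h2
      simp [h1', hXD, h2']) with h | h
  · rw [injective_iff_map_eq_zero]
    intro u hu
    have : ((0, u) : V × U) ∈ Submodule.prod ⊥ (LinearMap.ker X) := by simp [hu]
    rw [h] at this
    simpa using this
  · obtain ⟨v, hv⟩ := exists_ne (0 : V)
    have : ((v, 0) : V × U) ∈ Submodule.prod ⊥ (LinearMap.ker X) := by simp [h]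
    simp [hv] at this

/-- DY = Y(c - A) makes V × range Y invariant, and it is not zero. -/
theorem block_Y_surjective [Nontrivial V]
    (hirr : TupleIrreducible (okubo (blockProj U P) (blockMap A X Y D)))
    (hDY : ∀ v, D (Y v) = c • Y v - Y (A v)) : Function.Surjective Y := by
  rcases block_cases (T := Submodule.prod ⊤ (LinearMap.range Y)) hirr (fun j v _ => by simp)
    (fun v hv => by
      obtain ⟨-, w, hw⟩ := hv
      refine ⟨Submodule.mem_top, v.1 + (c • w - A w), ?_⟩
      simp only [map_add, map_sub, map_smul, ← hDY]
      rw [hw]) with h | h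
  · obtain ⟨v, hv⟩ := exists_ne (0 : V)
    have : ((v, 0) : V × U) ∈ Submodule.prod ⊤ (LinearMap.range Y) := by simp
    rw [h] at this
    simp [hv] at this
  · intro u
    have : ((0, u) : V × U) ∈ Submodule.prod ⊤ (LinearMap.range Y) := h ▸ Submodule.mem_top
    exact this.2

/-- If A v = 0, then D (Y v) = c Y v, so Y v = 0 and ker A × 0 is invariant. In the main theorem
this is where μ₁ + μ₂ ≠ λ_{p,ν} enters. -/
theorem block_A_injective [Nontrivial U]
    (hirr : TupleIrreducible (okubo (blockProj U P) (blockMap A X Y D)))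
    (hDY : ∀ v, D (Y v) = c • Y v - Y (A v)) (hD : ∀ u, D u = c • u → u = 0) :
    Function.Injective A := by
  rcases block_cases (T := Submodule.prod (LinearMap.ker A) ⊥) hirr (fun j v hv => by
      obtain ⟨h1, h2⟩ := hv
      have h1' : A v.1 = 0 := h1
      have h2' : v.2 = 0 := h2
      simp [h1', h2'])
    (fun v hv => by
      obtain ⟨h1, h2⟩ := hv
      have h1' : A v.1 = 0 := h1
      have h2' : v.2 = 0 := h2
      have h3 : Y v.1 = 0 := hD _ (by rw [hDY, h1', map_zero, sub_zero])
      simp [h2', h3]) with h | h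
  · rw [injective_iff_map_eq_zero]
    intro v hv
    have : ((v, 0) : V × U) ∈ Submodule.prod (LinearMap.ker A) ⊥ := by simp [hv]
    rw [h] at this
    simpa using this
  · obtain ⟨u, hu⟩ := exists_ne (0 : U)
    have : ((0, u) : V × U) ∈ Submodule.prod (LinearMap.ker A) ⊥ := by simp [h]
    simp [hu] at this

/-- Deleting the last block preserves irreducibility. -/
theorem block_restrict_irreducible (hP : CompleteOrthogonalIdempotents P)
    (hirr : TupleIrreducible (okubo (blockProj U P) (blockMap A X Y D)))
    (hXY : ∀ v, X (Y v) = c • A v - d • v - A (A v))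
    (hDY : ∀ v, D (Y v) = c • Y v - Y (A v)) (hA : Function.Injective A) :
    TupleIrreducible (okubo P A) := by
  intro S hS
  -- the largest graded subspace of `S`
  let S' : Submodule ℂ V := ⨅ j, S.comap (P j)
  have hmem : ∀ w, w ∈ S' ↔ ∀ j, P j w ∈ S := fun w => by simp [S']
  have hle : ∀ w ∈ S', w ∈ S := fun w hw => by
    rw [← hP.sum_apply w]
    exact Submodule.sum_mem _ fun j _ => (hmem w).1 hw j
  have hAS : ∀ w ∈ S, A w ∈ S' := fun w hw => (hmem _).2 fun j => hS j w hw
  have hPS : ∀ j, ∀ w ∈ S', P j w ∈ S' := fun j w hw => (hmem _).2 fun i => by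
    by_cases hij : i = j
    · subst hij
      rw [hP.apply_self]
      exact (hmem w).1 hw i
    · rw [hP.apply_of_ne hij]
      exact Submodule.zero_mem _
  -- `S` need not be graded, but A maps it into `S'`. Since XY is a polynomial in `A` and DY = Y(c -
  -- A), the subspace S' × Y(S') is invariant. If it is zero, A kills `S`, and injectivity gives S =
  -- 0.
  rcases block_cases (T := Submodule.prod S' (S'.map Y)) hirr (fun j v hv => by
      obtain ⟨h1, w, hw, hwv⟩ := hv
      refine ⟨hPS j _ (S'.add_mem (hAS _ (hle _ h1)) ?_), Submodule.zero_mem _⟩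
      rw [← hwv, hXY]
      have h2 := hAS _ (hle _ hw)
      exact S'.sub_mem (S'.sub_mem (S'.smul_mem _ h2) (S'.smul_mem _ hw)) (hAS _ (hle _ h2)))
    (fun v hv => by
      obtain ⟨h1, w, hw, hwv⟩ := hv
      refine ⟨Submodule.zero_mem _, v.1 + (c • w - A w), ?_, ?_⟩
      · exact S'.add_mem h1 (S'.sub_mem (S'.smul_mem _ hw) (hAS _ (hle _ hw)))
      · simp only [map_add, map_sub, map_smul, ← hDY]
        rw [hwv]) with h | h
  · left
    rw [eq_bot_iff]
    intro w hw
    have : ((A w, Y (A w)) : V × U) ∈ Submodule.prod S' (S'.map Y) :=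
      ⟨hAS w hw, A w, hAS w hw, rfl⟩
    rw [h, Submodule.mem_bot, Prod.mk_eq_zero, map_eq_zero_iff _ hA] at this
    exact this.1
  · right
    rw [eq_top_iff]
    intro w _
    have : ((w, 0) : V × U) ∈ Submodule.prod S' (S'.map Y) := h ▸ Submodule.mem_top
    exact hle w this.1

/-- A conjugacy between Okubo tuples respects the gradings, hence restricts to the first
blocks. -/
theorem tupleEquiv_of_blockMap {V' U' : Type*} [AddCommGroup V'] [Module ℂ V'] [AddCommGroup U']
    [Module ℂ U'] {P' : Fin p → Module.End ℂ V'} {A' : Module.End ℂ V'} {X' : U' →ₗ[ℂ] V'}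
    {Y' : V' →ₗ[ℂ] U'} {D' : Module.End ℂ U'} (hP : CompleteOrthogonalIdempotents P)
    (hP' : CompleteOrthogonalIdempotents P') (hF : Function.Surjective (blockMap A X Y D))
    (h : TupleEquiv (okubo (blockProj U P) (blockMap A X Y D))
      (okubo (blockProj U' P') (blockMap A' X' Y' D'))) :
    TupleEquiv (okubo P A) (okubo P' A') := by
  obtain ⟨e, he⟩ := h
  have heF : ∀ x, e (blockMap A X Y D x) = blockMap A' X' Y' D' (e x) := by
    intro x
    rw [← sum_okubo hP.blockProj, ← sum_okubo hP'.blockProj, map_sum]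
    exact Finset.sum_congr rfl fun j _ => he j x
  -- The conjugacy only relates the products P_j F; surjectivity of `F` lets `F` be cancelled.
  have heP : ∀ j x, e (blockProj U P j x) = blockProj U' P' j (e x) := by
    intro j x
    obtain ⟨y, rfl⟩ := hF x
    rw [heF]
    exact he j y
  have hsnd : ∀ x : V × U, (e x).2 = 0 ↔ x.2 = 0 := by
    intro x
    have h1 := heP (Fin.last p) x
    rw [blockProj_last, blockProj_last] at h1
    have h2 : e (0, x.2) = 0 ↔ x.2 = 0 := by rw [e.map_eq_zero_iff]; simp
    rw [← h2, h1]
    simp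
  let φ : V →ₗ[ℂ] V' := LinearMap.fst ℂ V' U' ∘ₗ e.toLinearMap ∘ₗ LinearMap.inl ℂ V U
  have hφ : ∀ v, e (v, 0) = (φ v, 0) := fun v => Prod.ext rfl ((hsnd (v, 0)).2 rfl)
  refine ⟨LinearEquiv.ofBijective φ ⟨?_, fun v => ?_⟩, fun j v => ?_⟩
  · rw [injective_iff_map_eq_zero]
    intro v hv
    have h1 := hφ v
    rw [hv, Prod.mk_zero_zero, e.map_eq_zero_iff, Prod.mk_eq_zero] at h1
    exact h1.1
  · obtain ⟨⟨w, u⟩, hx⟩ := e.surjective (v, 0)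
    have h1 := (hsnd (w, u)).1 (by rw [hx])
    simp only at h1
    subst h1
    rw [hφ] at hx
    exact ⟨w, congrArg Prod.fst hx⟩
  · have h1 := he j.castSucc (v, 0)
    rw [hφ, okubo_apply, okubo_apply, blockProj_castSucc, blockProj_castSucc, hφ] at h1
    simp only [blockMap_apply, map_zero, add_zero] at h1
    exact congrArg Prod.fst h1

theorem subsingleton_mcSpace {q : ℕ} {W : Type*} [AddCommGroup W] [Module ℂ W] [Subsingleton W]
    (c : ℂ) (B : Fin q → Module.End ℂ W) : Subsingleton (MCSpace c B) :=
  (Submodule.Quotient.mk_surjective _).subsingleton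

/-- An irreducible Okubo tuple is determined by its extension. -/
theorem tupleEquiv_of_extendingOp {V' U' : Type*} [AddCommGroup V'] [Module ℂ V']
    [AddCommGroup U'] [Module ℂ U'] [Nontrivial V'] {P' : Fin p → Module.End ℂ V'}
    {A' : Module.End ℂ V'} {X' : U' →ₗ[ℂ] V'} {Y' : V' →ₗ[ℂ] U'} {D' : Module.End ℂ U'}
    [FiniteDimensional ℂ V] {μ₁ μ₂ : ℂ} (hμ₁ : μ₁ ≠ 0) (hμ₂ : μ₂ ≠ 0)
    (hP : CompleteOrthogonalIdempotents P) (hP' : CompleteOrthogonalIdempotents P')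
    (hirr : TupleIrreducible (okubo P A))
    (h : TupleEquiv (extendingOp μ₁ μ₂ (okubo P A))
      (okubo (blockProj U' P') (blockMap A' X' Y' D'))) :
    TupleEquiv (okubo P A) (okubo P' A') := by
  -- Both A = 0 and A = μ₁ would make mc_{-μ₁}, hence the extension, the zero space, whereas the
  -- target contains V' ≠ 0.
  have hns : ¬Subsingleton (MCSpace (-μ₁) (okubo P A)) := by
    intro hs
    obtain ⟨e, -⟩ := h
    have h1 := subsingleton_mcSpace μ₁ (addition (Pi.single (Fin.last p) (μ₂ - μ₁))
      (swapInfinity (Fin.last p) (appendZero (mc (-μ₁) (okubo P A)))))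
    obtain ⟨v, hv⟩ := exists_ne (0 : V')
    have h2 := congrArg e (Subsingleton.elim (e.symm (v, 0)) 0)
    rw [e.apply_symm_apply, map_zero] at h2
    exact hv (congrArg Prod.fst h2)
  have hA0 : A ≠ 0 := by
    rintro rfl
    apply hns
    rw [Submodule.Quotient.subsingleton_iff, eq_top_iff]
    intro u _
    exact Submodule.mem_sup_left (mem_convK.2 fun j => by rw [okubo_apply]; simp)
  have hA := hirr.injective_of_ne_zero hA0
  have hA' : Function.Bijective A := ⟨hA, LinearMap.injective_iff_surjective.1 hA⟩
  have hR : A - μ₁ • 1 ≠ 0 := by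
    intro h0
    apply hns
    obtain ⟨e, -⟩ := mc_okubo hP hA' hμ₁
    have : Subsingleton (LinearMap.range (A - μ₁ • 1)) := by
      rw [h0, LinearMap.range_zero]
      infer_instance
    exact e.injective.subsingleton
  obtain ⟨hRi, hRs⟩ := hirr.block_injective_surjective hP hR
  -- A last block for the given tuple, dictated by the quadratic relation: U = range Q, with `X` the
  -- inclusion, Y = Q and D = μ₁ + μ₂ - A.
  let Q : Module.End ℂ V := (μ₂ • 1 - A) * (A - μ₁ • 1)
  have hQ : ∀ v, Q v = (μ₁ + μ₂) • A v - (μ₁ * μ₂) • v - A (A v) := by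
    intro v
    simp only [Q, Module.End.mul_apply, LinearMap.sub_apply, LinearMap.smul_apply,
      Module.End.one_apply, map_sub, map_smul]
    module
  let B : Module.End ℂ V := (μ₁ + μ₂) • 1 - A
  have hB : ∀ v, B v = (μ₁ + μ₂) • v - A v := fun v => by simp [B]
  have hBQ : ∀ v ∈ LinearMap.range Q, B v ∈ LinearMap.range Q := by
    rintro _ ⟨v, rfl⟩
    refine ⟨B v, ?_⟩
    simp only [hQ, hB, map_sub, map_smul]
    module
  have hF : Function.Injective
      (blockMap A (LinearMap.range Q).subtype Q.rangeRestrict (B.restrict hBQ)) := by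
    rw [injective_iff_map_eq_zero]
    rintro ⟨v, u⟩ hvu
    rw [blockMap_apply, Prod.mk_eq_zero] at hvu
    have h1 : (u : V) = -A v := by
      rw [eq_neg_iff_add_eq_zero, add_comm]
      exact hvu.1
    have h2 : Q v + B u = 0 := congrArg Subtype.val hvu.2
    -- Substituting u = -A v into the second row leaves only -μ₁μ₂ v.
    have h3 : (μ₁ * μ₂) • v = 0 := by
      rw [← neg_eq_zero, ← h2, hQ, hB, h1, map_neg]
      module
    have h4 : v = 0 := (smul_eq_zero.1 h3).resolve_left (mul_ne_zero hμ₁ hμ₂)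
    refine Prod.ext h4 (Subtype.ext ?_)
    rw [h1, h4, map_zero, neg_zero]
    rfl
  have hE := extendingOp_okubo (μ₂ := μ₂) (D := B.restrict hBQ) hP hA' hμ₁ hRi hRs
    (LinearMap.range Q).injective_subtype (LinearMap.surjective_rangeRestrict Q)
    (fun v => by
      change Q v = _
      simp [Q]) (fun u => hB u) hF
  exact tupleEquiv_of_blockMap hP hP' (LinearMap.injective_iff_surjective.1 hF)
    (hE.symm.trans h)

end Irreducible

/-! ### Spectral data of the deleted block -/

section Spectral

variable {V U : Type*} [AddCommGroup V] [Module ℂ V] [AddCommGroup U] [Module ℂ U]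

theorem HasSpectralData.exists_mem_of_eigenvector {f : Module.End ℂ V} {l : List (ℂ × ℕ)}
    (h : HasSpectralData f l) {c : ℂ} {v : V} (hv : f v = c • v) (h0 : v ≠ 0) :
    ∃ x ∈ l, x.1 = c := by
  have := h.finiteDimensional
  obtain ⟨l', hp, -, hk⟩ := h.exists_sorted
  have h1 : 0 < Module.finrank ℂ (LinearMap.ker ((f - c • 1) ^ 1)) := by
    rw [Module.finrank_pos_iff_exists_ne_zero]
    refine ⟨⟨v, ?_⟩, fun h => h0 (congrArg Subtype.val h)⟩
    rw [LinearMap.mem_ker, pow_one]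
    simp [hv]
  rw [hk.2] at h1
  have h2 : multiplicities l' c ≠ [] := by
    intro h2
    simp [h2] at h1
  obtain ⟨m, hm⟩ := List.exists_mem_of_ne_nil _ h2
  obtain ⟨x, hx, -⟩ := List.mem_map.1 hm
  rw [List.mem_filter] at hx
  exact ⟨x, hp.mem_iff.1 hx.1, by simpa using hx.2⟩

/-- Two reductions exhaust the list and end in the zero space, so (f - b)(f - a) = 0; a = b is
allowed. -/
theorem HasKernelDims.quadratic [FiniteDimensional ℂ V] {f : Module.End ℂ V} {a b : ℂ} {m n : ℕ}
    (h : HasKernelDims f [(a, m), (b, n)]) (v : V) :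
    f (f v) = (a + b) • f v - (a * b) • v := by
  have H := exists_isReduction_range a f
  obtain ⟨h1, -⟩ := (H.hasKernelDims_iff m _).1 h
  have H' := exists_isReduction_range b
    (a • 1 + (f - a • 1).rangeRestrict ∘ₗ (LinearMap.range (f - a • 1)).subtype)
  obtain ⟨h2, -⟩ := (H'.hasKernelDims_iff n _).1 h1
  have hs := Module.finrank_zero_iff.1 h2.1
  have h3 := congrArg Subtype.val (H'.eq_left ((f - a • 1).rangeRestrict v))
  rw [Subsingleton.elim (LinearMap.rangeRestrict _ ((f - a • 1).rangeRestrict v)) 0] at h3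
  have h4 : a • (f v - a • v) + (f (f v - a • v) - a • (f v - a • v)) =
      b • (f v - a • v) + 0 := h3
  rw [map_sub, map_smul] at h4
  have h5 : f (f v) = (a • (f v - a • v) + (f (f v) - a • f v - a • (f v - a • v))) + a • f v := by
    module
  rw [h5, h4]
  module

/-- The spectral data of the upper left block of a matrix with at most two eigenvalue entries. -/
theorem HasKernelDims.blockMap_upper [FiniteDimensional ℂ V] [FiniteDimensional ℂ U]
    {A : Module.End ℂ V} {X : U →ₗ[ℂ] V} {Y : V →ₗ[ℂ] U} {D : Module.End ℂ U} {a b : ℂ} {m n : ℕ}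
    (hX : Function.Injective X) (hY : Function.Surjective Y)
    (h : HasKernelDims (blockMap A X Y D) [(a, m), (b, n)]) :
    Module.finrank ℂ U ≤ m ∧ Module.finrank ℂ U ≤ n ∧
      ∀ l, HasSpectralData ((a + b) • 1 - D) l →
        HasSpectralData A ((a, m - Module.finrank ℂ U) :: (b, n - Module.finrank ℂ U) :: l) := by
  have hq := h.quadratic
  obtain ⟨hXY, hXD, -⟩ := block_quadratic hq
  have hdim : Module.finrank ℂ V + Module.finrank ℂ U = m + n := by
    have := h.1
    rw [Module.finrank_prod] at this
    simpa using this
  have hm : Module.finrank ℂ (LinearMap.ker (blockMap A X Y D - a • 1)) = m := by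
    have h1 := (((exists_isReduction_range a (blockMap A X Y D)).hasKernelDims_iff m _).1 h).2
    have h2 := (exists_isReduction_range a (blockMap A X Y D)).finrank_ker
    omega
  -- ker (F - a) projects onto `U`, since (F - b)(v, 0) lies in it and has second coordinate Y v.
  -- The fibre over 0 is ker (A - a): A v = a v gives X Y v = 0, hence Y v = 0.
  have hker : Module.finrank ℂ (LinearMap.ker (A - a • 1)) + Module.finrank ℂ U = m := by
    let π : LinearMap.ker (blockMap A X Y D - a • 1) →ₗ[ℂ] U :=
      LinearMap.snd ℂ V U ∘ₗ (LinearMap.ker (blockMap A X Y D - a • 1)).subtype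
    have hπ : Function.Surjective π := by
      intro u
      obtain ⟨v, rfl⟩ := hY u
      refine ⟨⟨blockMap A X Y D (v, 0) - b • (v, 0), ?_⟩, ?_⟩
      · simp only [LinearMap.mem_ker, LinearMap.sub_apply, map_sub, map_smul, hq,
          LinearMap.smul_apply, Module.End.one_apply]
        module
      · simp [π]
    have hπker : Module.finrank ℂ (LinearMap.ker π) =
        Module.finrank ℂ (LinearMap.ker (A - a • 1)) := by
      have hin : ∀ v ∈ LinearMap.ker (A - a • 1),
          (LinearMap.inl ℂ V U) v ∈ LinearMap.ker (blockMap A X Y D - a • 1) := by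
        intro v hv
        have hv' : A v = a • v := by simpa [sub_eq_zero] using hv
        have hYv : Y v = 0 := hX (by
          rw [hXY, hv', map_smul, hv', map_zero]
          module)
        simp [hv', hYv]
      refine (LinearEquiv.ofBijective (LinearMap.codRestrict (LinearMap.ker π)
        ((LinearMap.inl ℂ V U).restrict hin) fun v => rfl) ⟨?_, ?_⟩).finrank_eq.symm
      · intro v w hvw
        exact Subtype.ext (congrArg (fun x : LinearMap.ker π =>
          ((x : LinearMap.ker (blockMap A X Y D - a • 1)) : V × U).1) hvw)
      · rintro ⟨⟨⟨v, u⟩, hvu⟩, hu⟩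
        have hu' : u = 0 := hu
        subst hu'
        refine ⟨⟨v, ?_⟩, rfl⟩
        have := congrArg Prod.fst (LinearMap.mem_ker.1 hvu)
        simpa using this
    have h1 := π.finrank_range_add_finrank_ker
    rw [LinearMap.range_eq_top.2 hπ, finrank_top] at h1
    omega
  have H₁ := exists_isReduction_range a A
  have hU₁ := H₁.finrank_ker
  have hmem : ∀ u, X u ∈ LinearMap.range (A - a • 1) := by
    intro u
    obtain ⟨v, rfl⟩ := hY u
    refine ⟨b • v - A v, ?_⟩
    rw [hXY]
    simp only [LinearMap.sub_apply, map_sub, map_smul, LinearMap.smul_apply, Module.End.one_apply]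
    module
  have hmem' : ∀ z : LinearMap.range (A - a • 1),
      ((A - b • 1) ∘ₗ (LinearMap.range (A - a • 1)).subtype) z ∈ LinearMap.range X := by
    rintro ⟨_, v, rfl⟩
    refine ⟨-Y v, ?_⟩
    rw [map_neg, hXY]
    simp only [LinearMap.comp_apply, Submodule.subtype_apply, LinearMap.sub_apply, map_sub,
      map_smul, LinearMap.smul_apply, Module.End.one_apply]
    module
  obtain ⟨s, hs⟩ := LinearMap.exists_comp_eq_of_range_le hX _ hmem'
  have hXs : ∀ z : LinearMap.range (A - a • 1), X (s z) = A z - b • (z : V) := fun z => by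
    simpa using hs z
  -- On the range of A - a, the map A - b factors through `X` because (A - b)(A - a) = -XY. The
  -- second reduction thus lives on `U`, where b + sX = a + b - D by the relation for XD.
  have H₂ : IsReduction b
      (a • 1 + (A - a • 1).rangeRestrict ∘ₗ (LinearMap.range (A - a • 1)).subtype)
      ((a + b) • 1 - D) (LinearMap.codRestrict _ X hmem) s :=
    { inj := fun u w huw => hX (congrArg Subtype.val huw)
      surj := fun u => by
        obtain ⟨v, rfl⟩ := hY u
        refine ⟨⟨(A - a • 1) (-v), -v, rfl⟩, hX ?_⟩
        rw [hXs, hXY]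
        simp only [LinearMap.sub_apply, map_sub, map_smul, LinearMap.smul_apply,
          Module.End.one_apply, map_neg]
        module
      eq_left := fun z => by
        refine Subtype.ext ?_
        change a • (z : V) + (A z - a • (z : V)) = b • (z : V) + X (s z)
        rw [hXs]
        abel
      eq_right := fun u => hX (by
        rw [map_add, hXs]
        change X ((a + b) • u - D u) = X (b • u) + (A (X u) - b • X u)
        rw [map_sub, hXD, map_smul, map_smul]
        abel) }
  have hn : Module.finrank ℂ U ≤ n := by
    have := LinearMap.finrank_le_finrank_of_surjective (f := s) H₂.surj
    omega
  refine ⟨by omega, hn, fun l hl => ?_⟩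
  exact H₁.hasSpectralData_cons (by omega) (H₂.hasSpectralData_cons (by omega) hl)

end Spectral

/-! ### Okubo systems in block form -/

namespace OkuboSystem

variable {p : ℕ}

/-- The projection onto the `j`-th block. -/
def proj (S : OkuboSystem p) (j : Fin p) : Module.End ℂ ((Σ j, Fin (S.size j)) → ℂ) where
  toFun v := fun i => if i.1 = j then v i else 0
  map_add' v w := by
    funext i
    by_cases h : i.1 = j <;> simp [h]
  map_smul' c v := by
    funext i
    by_cases h : i.1 = j <;> simp [h]

theorem proj_apply (S : OkuboSystem p) (j : Fin p) (v) (i) :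
    S.proj j v i = if i.1 = j then v i else 0 := rfl

theorem completeOrthogonalIdempotents_proj (S : OkuboSystem p) :
    CompleteOrthogonalIdempotents S.proj := by
  rw [CompleteOrthogonalIdempotents.iff_ortho_complete]
  constructor
  · intro i j hij
    refine LinearMap.ext fun v => funext fun k => ?_
    rw [Module.End.mul_apply, proj_apply, proj_apply]
    by_cases h : k.1 = i
    · have : k.1 ≠ j := fun h' => hij (h.symm.trans h')
      simp [this]
    · simp [h]
  · refine LinearMap.ext fun v => funext fun k => ?_
    simp [LinearMap.sum_apply, Finset.sum_apply, proj_apply]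

theorem residue_eq_okubo (S : OkuboSystem p) :
    S.residue = okubo S.proj (Matrix.toLin' S.A) := by
  funext j
  refine LinearMap.ext fun v => funext fun i => ?_
  rw [okubo_apply, proj_apply, residue, Matrix.toLin'_apply, Matrix.toLin'_apply]
  by_cases h : i.1 = j <;> simp [Matrix.mulVec, dotProduct, h]

/-- The positions in the `j`-th block. -/
def blockPos (S : OkuboSystem p) (j : Fin p) (b : Fin (S.size j)) : Σ j, Fin (S.size j) := ⟨j, b⟩

theorem firstBlocks_injective (n : Fin (p + 1) → ℕ) : Function.Injective (firstBlocks n) := by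
  rintro ⟨i, b⟩ ⟨j, c⟩ h
  simp only [firstBlocks, Sigma.mk.injEq, Fin.castSucc_inj] at h
  obtain ⟨rfl, h⟩ := h
  rw [eq_of_heq h]

/-- The positions outside the last block. -/
def firstPos (S : OkuboSystem (p + 1)) (i : Σ j, Fin (S.restrict.size j)) :
    Σ j, Fin (S.size j) :=
  firstBlocks S.size i

theorem firstPos_fst (S : OkuboSystem (p + 1)) (i) : (S.firstPos i).1 = i.1.castSucc := rfl

/-- The diagonal block `A_{jj}`. -/
def diagBlock (S : OkuboSystem p) (j : Fin p) : Module.End ℂ (Fin (S.size j) → ℂ) :=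
  Matrix.toLin' (S.A.submatrix (S.blockPos j) (S.blockPos j))

/-- The inclusion of the `j`-th block. -/
def incl (S : OkuboSystem p) (j : Fin p) :
    (Fin (S.size j) → ℂ) →ₗ[ℂ] ((Σ j, Fin (S.size j)) → ℂ) where
  toFun w := fun i => Pi.single (M := fun j => Fin (S.size j) → ℂ) j w i.1 i.2
  map_add' v w := by
    funext i
    rw [Pi.single_add]
    rfl
  map_smul' c v := by
    funext i
    rw [Pi.single_smul]
    rfl

theorem incl_self (S : OkuboSystem p) (j : Fin p) (w) (b) : S.incl j w (S.blockPos j b) = w b := by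
  simp [incl, blockPos]

theorem incl_of_ne (S : OkuboSystem p) {i j : Fin p} (h : i ≠ j) (w) (b) :
    S.incl j w (S.blockPos i b) = 0 := by
  simp [incl, blockPos, h]

/-- A_j is the j-th block row of `A` followed by the inclusion of the block; in the opposite order
the two compose to A_jj. -/
theorem isReduction_residue (S : OkuboSystem p)
    (hA : Function.Surjective (Matrix.toLin' S.A)) (j : Fin p) :
    IsReduction 0 (S.residue j) (S.diagBlock j) (S.incl j)
      (LinearMap.funLeft ℂ ℂ (S.blockPos j) ∘ₗ Matrix.toLin' S.A) where
  inj v w h := funext fun b => by rw [← S.incl_self j v, h, S.incl_self]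
  surj := by
    rw [LinearMap.coe_comp]
    refine Function.Surjective.comp (fun w => ⟨S.incl j w, ?_⟩) hA
    funext b
    exact S.incl_self j w b
  eq_left v := by
    rw [zero_smul, zero_add, residue_eq_okubo, okubo_apply]
    funext ⟨i, b⟩
    change _ = S.incl j _ (S.blockPos i b)
    rw [proj_apply]
    by_cases h : i = j
    · subst h
      rw [if_pos rfl, incl_self]
      rfl
    · rw [if_neg h, incl_of_ne _ h]
  eq_right w := by
    rw [zero_smul, zero_add]
    funext b
    rw [LinearMap.comp_apply, LinearMap.funLeft_apply, diagBlock, Matrix.toLin'_apply,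
      Matrix.toLin'_apply, Matrix.mulVec, Matrix.mulVec, dotProduct, dotProduct,
      Fintype.sum_sigma, Finset.sum_eq_single j]
    · refine Finset.sum_congr rfl fun b' _ => ?_
      exact congrArg _ (S.incl_self j w b').symm
    · intro i _ hi
      refine Finset.sum_eq_zero fun b' _ => mul_eq_zero_of_right _ (S.incl_of_ne hi w b')
    · simp

/-- The column at t_j depends only on A_jj, up to the entry at 0, so restriction preserves it. -/
theorem hasSpectralData_residue_iff (S : OkuboSystem p)
    (hA : Function.Surjective (Matrix.toLin' S.A)) (j : Fin p) (l : List (ℂ × ℕ)) :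
    HasSpectralData (S.residue j) ((0, S.rank - S.size j) :: l) ↔
      HasSpectralData (S.diagBlock j) l := by
  have hle : S.size j ≤ S.rank := Finset.single_le_sum (f := S.size) (by simp) (Finset.mem_univ j)
  have hdim : Module.finrank ℂ ((Σ j, Fin (S.size j)) → ℂ) =
      (S.rank - S.size j) + Module.finrank ℂ (Fin (S.size j) → ℂ) := by
    rw [Module.finrank_fintype_fun_eq_card, Module.finrank_fintype_fun_eq_card, Fintype.card_sigma]
    simp only [Fintype.card_fin]
    change S.rank = _
    omega
  exact ⟨(S.isReduction_residue hA j).hasSpectralData_of_cons hdim,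
    (S.isReduction_residue hA j).hasSpectralData_cons hdim⟩

theorem diagBlock_restrict (S : OkuboSystem (p + 1)) (j : Fin p) :
    S.diagBlock j.castSucc = S.restrict.diagBlock j := rfl

/-- The upper right block column of `A`. -/
def upperRight (S : OkuboSystem (p + 1)) :
    (Fin (S.size (Fin.last p)) → ℂ) →ₗ[ℂ] ((Σ j, Fin (S.restrict.size j)) → ℂ) :=
  Matrix.toLin' (S.A.submatrix S.firstPos (S.blockPos (Fin.last p)))

/-- The lower left block row of `A`. -/
def lowerLeft (S : OkuboSystem (p + 1)) :
    ((Σ j, Fin (S.restrict.size j)) → ℂ) →ₗ[ℂ] (Fin (S.size (Fin.last p)) → ℂ) :=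
  Matrix.toLin' (S.A.submatrix (S.blockPos (Fin.last p)) S.firstPos)

/-- The block form of `A` with the last block split off. -/
def block (S : OkuboSystem (p + 1)) :
    Module.End ℂ (((Σ j, Fin (S.restrict.size j)) → ℂ) × (Fin (S.size (Fin.last p)) → ℂ)) :=
  blockMap (Matrix.toLin' S.restrict.A) S.upperRight S.lowerLeft (S.diagBlock (Fin.last p))

/-- Splitting off the coordinates of the last block. -/
def splitLast (S : OkuboSystem (p + 1)) : ((Σ j, Fin (S.size j)) → ℂ) ≃ₗ[ℂ]
    ((Σ j, Fin (S.restrict.size j)) → ℂ) × (Fin (S.size (Fin.last p)) → ℂ) :=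
  LinearEquiv.ofBijective
    ((LinearMap.funLeft ℂ ℂ S.firstPos).prod
      (LinearMap.funLeft ℂ ℂ (S.blockPos (Fin.last p))))
    ⟨by
      intro v w h
      funext ⟨j, b⟩
      induction j using Fin.lastCases with
      | last => exact congrFun (congrArg Prod.snd h) b
      | cast j => exact congrFun (congrArg Prod.fst h) ⟨j, b⟩, by
      rintro ⟨w, u⟩
      refine ⟨fun x => Fin.lastCases (motive := fun j => Fin (S.size j) → ℂ) u
        (fun j b => w ⟨j, b⟩) x.1 x.2, Prod.ext (funext fun x => ?_) (funext fun b => ?_)⟩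
      · simp [LinearMap.funLeft_apply, firstPos, firstBlocks]
      · simp [LinearMap.funLeft_apply, blockPos]⟩

theorem splitLast_fst (S : OkuboSystem (p + 1)) (v) (i) :
    (S.splitLast v).1 i = v (S.firstPos i) := rfl

theorem splitLast_snd (S : OkuboSystem (p + 1)) (v) (b) :
    (S.splitLast v).2 b = v (S.blockPos (Fin.last p) b) := rfl

theorem sum_split (S : OkuboSystem (p + 1)) (F : (Σ j, Fin (S.size j)) → ℂ) :
    ∑ i, F i = ∑ i : Σ j, Fin (S.restrict.size j), F (S.firstPos i) +
      ∑ b, F (S.blockPos (Fin.last p) b) := by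
  rw [Fintype.sum_sigma, Fin.sum_univ_castSucc, Fintype.sum_sigma]
  rfl

theorem splitLast_A (S : OkuboSystem (p + 1)) (v) :
    S.splitLast (Matrix.toLin' S.A v) = S.block (S.splitLast v) := by
  refine Prod.ext (funext fun i => ?_) (funext fun b => ?_)
  · rw [splitLast_fst, Matrix.toLin'_apply, Matrix.mulVec, dotProduct, sum_split]
    rfl
  · rw [splitLast_snd, Matrix.toLin'_apply, Matrix.mulVec, dotProduct, sum_split]
    rfl

theorem splitLast_proj (S : OkuboSystem (p + 1)) (j) (v) :
    S.splitLast (S.proj j v) =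
      blockProj (Fin (S.size (Fin.last p)) → ℂ) S.restrict.proj j (S.splitLast v) := by
  induction j using Fin.lastCases with
  | last =>
    rw [blockProj_last]
    refine Prod.ext (funext fun i => ?_) (funext fun b => ?_)
    · exact if_neg (Fin.castSucc_lt_last i.1).ne
    · exact if_pos rfl
  | cast j =>
    rw [blockProj_castSucc]
    refine Prod.ext (funext fun i => ?_) (funext fun b => ?_)
    · rw [splitLast_fst, proj_apply, firstPos_fst]
      simp only [Fin.castSucc_inj]
      rfl
    · exact if_neg (Fin.castSucc_lt_last j).ne'

theorem tupleEquiv_block (S : OkuboSystem (p + 1)) :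
    TupleEquiv S.residue
      (okubo (blockProj (Fin (S.size (Fin.last p)) → ℂ) S.restrict.proj) S.block) := by
  refine ⟨S.splitLast, fun j v => ?_⟩
  rw [residue_eq_okubo, okubo_apply, okubo_apply, splitLast_proj, splitLast_A]

theorem sum_residue (S : OkuboSystem p) : ∑ j, S.residue j = Matrix.toLin' S.A := by
  refine LinearMap.ext fun v => ?_
  rw [LinearMap.sum_apply, residue_eq_okubo]
  exact sum_okubo S.completeOrthogonalIdempotents_proj v

theorem nontrivial_space (S : OkuboSystem p) (hp : 1 ≤ p) :
    Nontrivial ((Σ j, Fin (S.size j)) → ℂ) := by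
  have : Nonempty (Σ j, Fin (S.size j)) := ⟨⟨⟨0, hp⟩, ⟨0, S.size_pos _⟩⟩⟩
  infer_instance

end OkuboSystem

theorem TupleEquiv.restrictingOp {p : ℕ} {V W : Type*} [AddCommGroup V] [Module ℂ V]
    [AddCommGroup W] [Module ℂ W] {A : Fin (p + 1) → Module.End ℂ V}
    {B : Fin (p + 1) → Module.End ℂ W} (h : TupleEquiv A B) (μ₁ μ₂ : ℂ) :
    TupleEquiv (restrictingOp μ₁ μ₂ A) (restrictingOp μ₁ μ₂ B) :=
  (((h.mc _).addition _).swapInfinity _).mc _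

theorem neg_blockMap {V U : Type*} [AddCommGroup V] [Module ℂ V] [AddCommGroup U] [Module ℂ U]
    (A : Module.End ℂ V) (X : U →ₗ[ℂ] V) (Y : V →ₗ[ℂ] U) (D : Module.End ℂ U) :
    -blockMap A X Y D = blockMap (-A) (-X) (-Y) (-D) := by
  refine LinearMap.ext fun v => Prod.ext ?_ ?_
  · simp [add_comm]
  · simp [add_comm]

theorem eq_or_eq_of_perm_pair {α : Type*} {l : List α} {x y : α} (h : l.Perm [x, y]) :
    l = [x, y] ∨ l = [y, x] := by
  obtain ⟨c, d, rfl⟩ := List.length_eq_two.1 h.length_eq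
  have hc : c ∈ [x, y] := h.mem_iff.1 List.mem_cons_self
  simp only [List.mem_cons, List.not_mem_nil, or_false] at hc
  rcases hc with rfl | rfl
  · left
    rw [List.singleton_perm_singleton.1 h.cons_inv]
  · right
    rw [List.singleton_perm_singleton.1 (h.trans (List.Perm.swap _ _ _)).cons_inv]

/-! ### The restricting operation on Okubo systems. -/

theorem mainTheorem3 {p : ℕ} (hp : 1 ≤ p) (S : OkuboSystem (p + 1))
    (hirr : TupleIrreducible S.residue)
    (μ₁ μ₂ : ℂ) (m₁ m₂ : ℕ) (col : Fin (p + 1) → List (ℂ × ℕ))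
    (hscheme : HasRiemannScheme S.residue [(-μ₁, m₁), (-μ₂, m₂)]
      (fun j => (0, S.rank - S.size j) :: col j))
    (hne : ∀ x ∈ col (Fin.last p), μ₁ + μ₂ ≠ x.1) :
    -- the operation produces the system given by the upper left blocks of `T` and `A`
    TupleEquiv (restrictingOp μ₁ μ₂ S.residue) (appendZero S.restrict.residue) ∧
    S.restrict.T = S.T.submatrix (OkuboSystem.firstBlocks S.size)
      (OkuboSystem.firstBlocks S.size) ∧
    S.restrict.A = S.A.submatrix (OkuboSystem.firstBlocks S.size)
      (OkuboSystem.firstBlocks S.size) ∧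
    -- its rank is `n - n_p`
    S.restrict.rank + S.size (Fin.last p) = S.rank ∧
    TupleIrreducible S.restrict.residue ∧
    -- its Riemann scheme
    S.size (Fin.last p) ≤ m₁ ∧ S.size (Fin.last p) ≤ m₂ ∧
    HasRiemannScheme S.restrict.residue
      ((-μ₁, m₁ - S.size (Fin.last p)) :: (-μ₂, m₂ - S.size (Fin.last p)) ::
        (col (Fin.last p)).map (fun x => (x.1 - μ₁ - μ₂, x.2)))
      (fun j => (0, S.restrict.rank - S.size j.castSucc) :: col j.castSucc) ∧
    -- the operation is inverse to the extending operation with parameters `μ₁, μ₂`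
    TupleEquiv (extendingOp μ₁ μ₂ S.restrict.residue) S.residue ∧
    (∀ S₀ : OkuboSystem p, TupleIrreducible S₀.residue →
      TupleEquiv (extendingOp μ₁ μ₂ S₀.residue) S.residue →
      TupleEquiv S₀.residue S.restrict.residue) := by
  have hV := S.restrict.nontrivial_space hp
  have hU : Nontrivial (Fin (S.size (Fin.last p)) → ℂ) := by
    have : Nonempty (Fin (S.size (Fin.last p))) := ⟨⟨0, S.size_pos _⟩⟩
    infer_instance
  have hP := S.restrict.completeOrthogonalIdempotents_proj
  have hUdim : Module.finrank ℂ (Fin (S.size (Fin.last p)) → ℂ) = S.size (Fin.last p) := by simp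
  have hirr' := hirr.of_equiv S.tupleEquiv_block
  obtain ⟨hinf, hfin⟩ := hscheme
  rw [S.sum_residue] at hinf
  -- the quadratic equation
  have hneg := hinf.of_equiv (g := -S.block) S.splitLast fun v => by
    rw [LinearMap.neg_apply, map_neg, S.splitLast_A, LinearMap.neg_apply]
  -- The spectral data fix the two entries only up to order, so both orders are carried along.
  have hdims : ∃ a b m n, ((a, m), (b, n)) ∈ [((-μ₁, m₁), (-μ₂, m₂)), ((-μ₂, m₂), (-μ₁, m₁))] ∧
      HasKernelDims (-S.block) [(a, m), (b, n)] := by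
    obtain ⟨l, hl, -, hk⟩ := hneg.exists_sorted
    rcases eq_or_eq_of_perm_pair hl with rfl | rfl
    · exact ⟨_, _, _, _, List.mem_cons_self, hk⟩
    · exact ⟨_, _, _, _, List.mem_cons_of_mem _ List.mem_cons_self, hk⟩
  have hq : ∀ v, S.block (S.block v) = (μ₁ + μ₂) • S.block v - (μ₁ * μ₂) • v := by
    intro v
    obtain ⟨a, b, m, n, hab, hk⟩ := hdims
    have := hk.quadratic v
    have hsum : a + b = -(μ₁ + μ₂) ∧ a * b = μ₁ * μ₂ := by
      simp only [List.mem_cons, Prod.mk.injEq, List.not_mem_nil, or_false] at hab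
      rcases hab with ⟨⟨rfl, rfl⟩, rfl, rfl⟩ | ⟨⟨rfl, rfl⟩, rfl, rfl⟩ <;>
        constructor <;> ring
    rw [hsum.1, hsum.2] at this
    rw [LinearMap.neg_apply, LinearMap.neg_apply, map_neg, neg_neg, smul_neg, neg_smul,
      neg_neg] at this
    exact this
  obtain ⟨hXY, hXD, hDY⟩ := block_quadratic hq
  have hF : Function.Injective S.block := block_injective hirr'
  have hF' : Function.Bijective S.block := ⟨hF, LinearMap.injective_iff_surjective.1 hF⟩
  have hX := block_X_injective hirr' hXD
  have hY := block_Y_surjective hirr' hDY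
  have hSA : Function.Surjective (Matrix.toLin' S.A) := by
    intro v
    obtain ⟨w, hw⟩ := hF'.2 (S.splitLast v)
    refine ⟨S.splitLast.symm w, S.splitLast.injective ?_⟩
    rw [S.splitLast_A, LinearEquiv.apply_symm_apply, hw]
  have hD := (S.hasSpectralData_residue_iff hSA _ _).1 (hfin (Fin.last p))
  have hDne : ∀ u, S.diagBlock (Fin.last p) u = (μ₁ + μ₂) • u → u = 0 := by
    intro u hu
    by_contra h0
    obtain ⟨x, hx, hx'⟩ := hD.exists_mem_of_eigenvector hu h0
    exact hne x hx hx'.symm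
  have hA := block_A_injective hirr' hDY hDne
  have hA' : Function.Bijective (Matrix.toLin' S.restrict.A) :=
    ⟨hA, LinearMap.injective_iff_surjective.1 hA⟩
  have hirrR : TupleIrreducible (okubo S.restrict.proj (Matrix.toLin' S.restrict.A)) :=
    block_restrict_irreducible hP hirr' hXY hDY hA
  -- `μ₁` and `μ₂` do not vanish
  have hμ : μ₁ * μ₂ ≠ 0 := by
    intro h0
    obtain ⟨u, hu⟩ := exists_ne (0 : Fin (S.size (Fin.last p)) → ℂ)
    obtain ⟨v, hv⟩ := hY u
    -- If μ₁μ₂ = 0, this reads F (F x) = F ((μ₁ + μ₂) x) at x = (v, 0), so injectivity makes (v, 0)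
    -- an eigenvector, against Y v ≠ 0.
    have h1 := hq (v, 0)
    rw [h0, zero_smul, sub_zero, ← map_smul] at h1
    have h2 := congrArg Prod.snd (hF h1)
    apply hu
    rw [← hv]
    simpa [OkuboSystem.block] using h2
  have hμ₁ : μ₁ ≠ 0 := left_ne_zero_of_mul hμ
  have hμ₂ : μ₂ ≠ 0 := right_ne_zero_of_mul hμ
  have hRF : S.block - μ₁ • 1 ≠ 0 := by
    intro h0
    obtain ⟨u, hu⟩ := exists_ne (0 : Fin (S.size (Fin.last p)) → ℂ)
    obtain ⟨v, hv⟩ := hY u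
    have h2 := congrArg Prod.snd (LinearMap.congr_fun h0 (v, 0))
    apply hu
    rw [← hv]
    simpa [OkuboSystem.block] using h2
  -- A = μ₁ would give XY = 0, against `X` injective and Y ≠ 0.
  have hRA : Matrix.toLin' S.restrict.A - μ₁ • 1 ≠ 0 := by
    intro h0
    obtain ⟨u, hu⟩ := exists_ne (0 : Fin (S.size (Fin.last p)) → ℂ)
    obtain ⟨v, hv⟩ := hY u
    have h1 : ∀ w, Matrix.toLin' S.restrict.A w = μ₁ • w := fun w => by
      simpa [sub_eq_zero] using LinearMap.congr_fun h0 w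
    apply hu
    rw [← hv]
    apply hX
    rw [hXY, h1, map_smul, h1, map_zero]
    module
  obtain ⟨hRi, hRs⟩ := hirr'.block_injective_surjective hP.blockProj hRF
  obtain ⟨hRi', hRs'⟩ := hirrR.block_injective_surjective hP hRA
  have hE : TupleEquiv (extendingOp μ₁ μ₂ S.restrict.residue) S.residue := by
    refine TupleEquiv.trans ?_ S.tupleEquiv_block.symm
    rw [S.restrict.residue_eq_okubo]
    refine extendingOp_okubo hP hA' hμ₁ hRi' hRs' hX hY (fun v => ?_) (fun u => hXD u) hF
    rw [hXY]
    simp only [LinearMap.sub_apply, map_sub, map_smul, LinearMap.smul_apply, Module.End.one_apply]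
    module
  have hrank : S.restrict.rank + S.size (Fin.last p) = S.rank :=
    (Fin.sum_univ_castSucc S.size).symm
  -- the spectral data at infinity
  have hcol : ∀ {a b : ℂ}, a + b = -(μ₁ + μ₂) →
      HasSpectralData ((a + b) • 1 - -S.diagBlock (Fin.last p))
        ((col (Fin.last p)).map fun x => (x.1 - μ₁ - μ₂, x.2)) := by
    intro a b hab
    have h1 := hD.add_smul (-(μ₁ + μ₂))
    rw [hab]
    convert h1 using 1
    · abel
    · refine List.map_congr_left fun x _ => Prod.ext ?_ rfl
      change x.1 - μ₁ - μ₂ = x.1 + -(μ₁ + μ₂)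
      ring
  have hnX : Function.Injective (-S.upperRight) := fun u w h => hX (neg_injective h)
  have hnY : Function.Surjective (-S.lowerLeft) := fun u => by
    obtain ⟨v, hv⟩ := hY (-u)
    exact ⟨v, by rw [LinearMap.neg_apply, hv, neg_neg]⟩
  have hupper : S.size (Fin.last p) ≤ m₁ ∧ S.size (Fin.last p) ≤ m₂ ∧
      HasSpectralData (-Matrix.toLin' S.restrict.A)
        ((-μ₁, m₁ - S.size (Fin.last p)) :: (-μ₂, m₂ - S.size (Fin.last p)) ::
          (col (Fin.last p)).map (fun x => (x.1 - μ₁ - μ₂, x.2))) := by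
    obtain ⟨a, b, m, n, hab, hk⟩ := hdims
    rw [OkuboSystem.block, neg_blockMap] at hk
    obtain ⟨h1, h2, h3⟩ := hk.blockMap_upper hnX hnY
    rw [hUdim] at h1 h2 h3
    simp only [List.mem_cons, Prod.mk.injEq, List.not_mem_nil, or_false] at hab
    rcases hab with ⟨⟨rfl, rfl⟩, rfl, rfl⟩ | ⟨⟨rfl, rfl⟩, rfl, rfl⟩
    · exact ⟨h1, h2, h3 _ (hcol (by ring))⟩
    · exact ⟨h2, h1, (h3 _ (hcol (by ring))).perm (List.Perm.swap _ _ _)⟩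
  refine ⟨?_, ?_, rfl, hrank, ?_, hupper.1, hupper.2.1, ⟨?_, fun j => ?_⟩, hE, ?_⟩
  · refine TupleEquiv.trans (S.tupleEquiv_block.restrictingOp μ₁ μ₂) ?_
    rw [S.restrict.residue_eq_okubo]
    refine restrictingOp_okubo hP hF' hμ₁ hRi hRs (fun v => ?_) hA
    have h1 := hq v
    change S.block ((S.block - μ₁ • 1) v) = μ₂ • (S.block - μ₁ • 1) v
    simp only [LinearMap.sub_apply, map_sub, map_smul, LinearMap.smul_apply, Module.End.one_apply,
      h1]
    module
  · exact (Matrix.submatrix_diagonal (fun i : Σ j, Fin (S.size j) => S.t i.1) _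
      (OkuboSystem.firstBlocks_injective S.size)).symm
  · rw [S.restrict.residue_eq_okubo]
    exact hirrR
  · rw [S.restrict.sum_residue]
    exact hupper.2.2
  · exact (S.restrict.hasSpectralData_residue_iff hA'.2 j _).2
      (S.diagBlock_restrict j ▸ (S.hasSpectralData_residue_iff hSA _ _).1 (hfin j.castSucc))
  · intro S₀ h₀ hE₀
    have h1 := hE₀.trans S.tupleEquiv_block
    rw [S₀.residue_eq_okubo] at h₀ h1 ⊢
    rw [S.restrict.residue_eq_okubo]
    exact tupleEquiv_of_extendingOp hμ₁ hμ₂ S₀.completeOrthogonalIdempotents_proj hP h₀ h1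

end
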